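/- A Frölicher space is a set $X$ with a set of structure curves $\mathbb{R}\to X$ and a set of structure functions $X\to\mathbb{R}$ such that a map $c:\mathbb{R}\to X$ is a structure curve iff $\chi\circ c$ is $C^\infty$ for every structure function $\chi$, and a map $\chi:X\to\mathbb{R}$ is a structure function iff $\chi\circ c$ is $C^\infty$ for every structure curve $c$. A map between Frölicher spaces is smooth if it sends structure curves to structure curves. Let $\mathbf{FS}$ be the category of Frölicher spaces and smooth maps, with one-point space $1$ and products $X\times Y$ (whose curves are the pairs of curves). For Frölicher spaces $X,Y$ let $X^Y$ be the set of smooth maps $Y\to X$ with the Frölicher structure generated by the curves $c:\mathbb{R}\to X^Y$ for which $(t,y)\mapsto c(t)(y)$, $\mathbb{R}\times Y\to X$, is smooth. A Weil algebra is a finite-dimensional commutative local $\mathbb{R}$-algebra $W=\mathbb{R}\oplus\mathfrak{m}$ with nilpotent maximal ideal $\mathfrak m$; let $\mathbf W$ be the category of Weil algebras and $\mathbb R$-algebra homomorphisms, and let $W_1\otimes_\infty W_2=W_1\otimes_{\mathbb R}W_2$. For $W=C^\infty(\mathbb{R}^n)/I$, presented so that the classes of the coordinate functions are nilpotent, the Weil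 prolongation $X\otimes W$ is the quotient of the Frölicher space $X^{\mathbb{R}^n}$ by the relation $f\sim g$ iff $f(0)=g(0)$ and $\chi\circ f-\chi\circ g\in I$ for every structure function $\chi$ of $X$; this is independent of the presentation and is a bifunctor $\mathbf{FS}\times\mathbf{W}\to\mathbf{FS}$. A Frölicher space $X$ is Weil exponentiable if there is an isomorphism $$(X\otimes(W_1\otimes_\infty W_2))^Y\;\cong\;(X\otimes W_1)^Y\otimes W_2$$ natural in the Frölicher space $Y$ and the Weil algebras $W_1,W_2$. It is microlinear if every finite limit diagram $\mathcal D$ of Weil algebras (a cone in $\mathbf W$ over a finite diagram in $\mathbf W$ that is a limit diagram of $\mathbb{R}$-algebras) yields a limit diagram $X\otimes\mathcal D$ in $\mathbf{FS}$. **Theorem.** The full subcategory $\mathbf{FS}_{\mathbf{WE,ML}}$ of $\mathbf{FS}$ whose objects are the Weil exponentiable and microlinear Frölicher spaces is a cartesian closed subcategory of $\mathbf{FS}$. That is: $1$ is Weil exponentiable and microlinear; if $X$ and $Y$ are Weil exponentiable and microlinear, then so are $X\times Y$ and $X^Y$; for every Frölicher space $Y$ the functor $(\cdot)^Y$ is right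 adjoint to $Y\times(\cdot)$ on $\mathbf{FS}$, with counit the evaluation $(y,f)\mapsto f(y)$; and consequently $\mathbf{FS}_{\mathbf{WE,ML}}$ is cartesian closed and its inclusion into $\mathbf{FS}$ preserves finite products and exponentials. -/

import Mathlib

open CategoryTheory MonoidalCategory CartesianMonoidalCategory Limits
open scoped ContDiff TensorProduct

universe u v w

noncomputable section

/-! ### Frölicher spaces and smooth maps -/

/-- A Frölicher structure on a set: a set of structure curves and a set of structure functions
which determine each other by the condition that all composites `ℝ → ℝ` are smooth. -/
class Frolicher (X : Type u) where
  curves : Set (ℝ → X)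
  functions : Set (X → ℝ)
  mem_curves_iff : ∀ c, c ∈ curves ↔ ∀ f ∈ functions, ContDiff ℝ ∞ (f ∘ c)
  mem_functions_iff : ∀ f, f ∈ functions ↔ ∀ c ∈ curves, ContDiff ℝ ∞ (f ∘ c)

namespace Frolicher

/-- The Frölicher structure generated by a set `C` of curves: the structure functions are the
functions that are smooth along all curves in `C`. -/
abbrev ofCurves {X : Type u} (C : Set (ℝ → X)) : Frolicher X where
  curves := {c | ∀ f : X → ℝ, (∀ γ ∈ C, ContDiff ℝ ∞ (f ∘ γ)) → ContDiff ℝ ∞ (f ∘ c)}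
  functions := {f | ∀ γ ∈ C, ContDiff ℝ ∞ (f ∘ γ)}
  mem_curves_iff _ := Iff.rfl
  mem_functions_iff f :=
    ⟨fun hf _ hc => hc f hf, fun h γ hγ => h γ fun _ hf => hf γ hγ⟩

/-- Smooth maps between Frölicher spaces: structure curves are sent to structure curves. -/
def IsSmooth {X : Type u} {Y : Type v} [Frolicher X] [Frolicher Y] (φ : X → Y) : Prop :=
  ∀ c ∈ curves (X := X), φ ∘ c ∈ curves (X := Y)

theorem IsSmooth.comp {X : Type u} {Y : Type v} {Z : Type w}
    [Frolicher X] [Frolicher Y] [Frolicher Z] {ψ : Y → Z} {φ : X → Y}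
    (hψ : IsSmooth ψ) (hφ : IsSmooth φ) : IsSmooth (ψ ∘ φ) :=
  fun c hc => hψ _ (hφ c hc)

theorem isSmooth_id {X : Type u} [Frolicher X] : IsSmooth (id : X → X) := fun _ hc => hc

theorem IsSmooth.comp_mem_functions {X : Type u} {Y : Type v} [Frolicher X] [Frolicher Y]
    {φ : X → Y} (hφ : IsSmooth φ) {f : Y → ℝ} (hf : f ∈ functions (X := Y)) :
    f ∘ φ ∈ functions (X := X) :=
  (mem_functions_iff _).2 fun c hc => (mem_functions_iff f).1 hf _ (hφ c hc)

theorem isSmooth_const {X : Type u} {Y : Type v} [Frolicher X] [Frolicher Y] (y : Y) :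
    IsSmooth (fun _ : X => y) :=
  fun _ _ => (mem_curves_iff _).2 fun f _ => (contDiff_const : ContDiff ℝ ∞ fun _ : ℝ => f y)

/-- A map out of a generated structure is smooth as soon as it is smooth along the generating
curves. -/
theorem isSmooth_ofCurves {X : Type u} {Y : Type v} [Frolicher Y] (C : Set (ℝ → X)) {φ : X → Y}
    (h : ∀ γ ∈ C, φ ∘ γ ∈ curves (X := Y)) : @IsSmooth X Y (ofCurves C) _ φ :=
  fun _ hc => (mem_curves_iff _).2 fun f hf =>
    hc (f ∘ φ) fun γ hγ => (mem_curves_iff _).1 (h γ hγ) f hf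

theorem mem_ofCurves {X : Type u} {C : Set (ℝ → X)} {γ : ℝ → X} (h : γ ∈ C) :
    γ ∈ @curves X (ofCurves C) :=
  fun _ hf => hf γ h

/-- The real line; both the curves and the functions are the smooth maps `ℝ → ℝ`. -/
instance instReal : Frolicher ℝ where
  curves := {c | ContDiff ℝ ∞ c}
  functions := {f | ContDiff ℝ ∞ f}
  mem_curves_iff _ := ⟨fun hc _ hf => ContDiff.comp (n := ∞) hf hc,
    fun h => h id (contDiff_id (n := ∞))⟩
  mem_functions_iff _ := ⟨fun hf _ hc => ContDiff.comp (n := ∞) hf hc,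
    fun h => h id (contDiff_id (n := ∞))⟩

/-- The one-point space. -/
instance instPUnit : Frolicher PUnit.{u + 1} where
  curves := Set.univ
  functions := Set.univ
  mem_curves_iff _ := ⟨fun _ f _ => (contDiff_const : ContDiff ℝ ∞ fun _ : ℝ => f PUnit.unit),
    fun _ => trivial⟩
  mem_functions_iff f :=
    ⟨fun _ _ _ => (contDiff_const : ContDiff ℝ ∞ fun _ : ℝ => f PUnit.unit), fun _ => trivial⟩

/-- The product of two Frölicher spaces; its curves are the pairs of curves. -/
instance instProd (X : Type u) (Y : Type v) [Frolicher X] [Frolicher Y] : Frolicher (X × Y) where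
  curves := {c | Prod.fst ∘ c ∈ curves (X := X) ∧ Prod.snd ∘ c ∈ curves (X := Y)}
  functions := {f | ∀ c : ℝ → X × Y, Prod.fst ∘ c ∈ curves (X := X) ∧
    Prod.snd ∘ c ∈ curves (X := Y) → ContDiff ℝ ∞ (f ∘ c)}
  mem_curves_iff c :=
    ⟨fun hc _ hf => hf c hc, fun h =>
      ⟨(mem_curves_iff _).2 fun f hf =>
        h (f ∘ Prod.fst) fun _ hc' => (mem_curves_iff _).1 hc'.1 f hf,
       (mem_curves_iff _).2 fun f hf =>
        h (f ∘ Prod.snd) fun _ hc' => (mem_curves_iff _).1 hc'.2 f hf⟩⟩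
  mem_functions_iff _ := Iff.rfl

/-- The product of a family of Frölicher spaces; its curves are the families of curves.
In particular this is the Frölicher structure of `ℝⁿ = (Fin n → ℝ)`, whose curves are the smooth
curves. -/
instance instPi {ι : Type v} (X : ι → Type u) [∀ i, Frolicher (X i)] :
    Frolicher (∀ i, X i) where
  curves := {c | ∀ i, (fun t => c t i) ∈ curves (X := X i)}
  functions := {f | ∀ c : ℝ → ∀ i, X i, (∀ i, (fun t => c t i) ∈ curves (X := X i)) →
    ContDiff ℝ ∞ (f ∘ c)}
  mem_curves_iff c :=
    ⟨fun hc _ hf => hf c hc, fun h i => (mem_curves_iff _).2 fun f hf =>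
      h (fun x => f (x i)) fun _ hc' => (mem_curves_iff _).1 (hc' i) f hf⟩
  mem_functions_iff _ := Iff.rfl

end Frolicher

open Frolicher

/-- The set `C^∞(X, Y)` of smooth maps. -/
@[ext]
structure SmoothMap (X : Type u) (Y : Type v) [Frolicher X] [Frolicher Y] where
  toFun : X → Y
  smooth : IsSmooth toFun

namespace SmoothMap

instance {X : Type u} {Y : Type v} [Frolicher X] [Frolicher Y] : FunLike (SmoothMap X Y) X Y where
  coe := toFun
  coe_injective _ _ h := SmoothMap.ext h

def id (X : Type u) [Frolicher X] : SmoothMap X X := ⟨_root_.id, isSmooth_id⟩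

def comp {X : Type u} {Y : Type v} {Z : Type w} [Frolicher X] [Frolicher Y] [Frolicher Z]
    (g : SmoothMap Y Z) (f : SmoothMap X Y) : SmoothMap X Z :=
  ⟨g.toFun ∘ f.toFun, g.smooth.comp f.smooth⟩

/-- The Frölicher structure on the function space `Y^X = C^∞(X, Y)`: it is generated by the curves
`c : ℝ → C^∞(X, Y)` for which `ℝ × X → Y`, `(t, x) ↦ c t x` is smooth. -/
instance instFrolicher (X : Type u) (Y : Type v) [Frolicher X] [Frolicher Y] :
    Frolicher (SmoothMap X Y) :=
  ofCurves {c | IsSmooth fun p : ℝ × X => c p.1 p.2}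

theorem isSmooth_comp_left {X : Type u} {Y : Type v} {Z : Type w}
    [Frolicher X] [Frolicher Y] [Frolicher Z] (g : SmoothMap Y Z) :
    IsSmooth fun f : SmoothMap X Y => g.comp f :=
  isSmooth_ofCurves _ fun _ hγ => mem_ofCurves (g.smooth.comp hγ)

theorem isSmooth_comp_right {X : Type u} {Y : Type v} {Z : Type w}
    [Frolicher X] [Frolicher Y] [Frolicher Z] (f : SmoothMap X Y) :
    IsSmooth fun g : SmoothMap Y Z => g.comp f :=
  isSmooth_ofCurves _ fun γ hγ => mem_ofCurves <| by
    have hf : IsSmooth fun p : ℝ × X => (p.1, f p.2) := fun c hc => ⟨hc.1, f.smooth _ hc.2⟩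
    exact hγ.comp hf

end SmoothMap

/-! ### The category of Frölicher spaces -/

/-- The objects of the category `FS` of Frölicher spaces and smooth maps. -/
structure FS : Type (u + 1) where
  carrier : Type u
  [str : Frolicher carrier]

namespace FS

instance : CoeSort FS.{u} (Type u) := ⟨carrier⟩

instance (X : FS.{u}) : Frolicher X := X.str

instance : Category.{u} FS.{u} where
  Hom X Y := SmoothMap X Y
  id X := SmoothMap.id X
  comp f g := SmoothMap.comp g f

instance : ConcreteCategory FS.{u} (fun X Y => SmoothMap X Y) where
  hom f := f
  ofHom f := f

/-- The one-point space is terminal. -/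
def terminalCone : LimitCone (Functor.empty.{0} FS.{u}) where
  cone := asEmptyCone ⟨PUnit.{u + 1}⟩
  isLimit := IsTerminal.ofUniqueHom (fun _ => ⟨fun _ => PUnit.unit, isSmooth_const _⟩)
    fun _ _ => SmoothMap.ext (funext fun _ => rfl)

/-- The product space is a categorical product. -/
def prodCone (X Y : FS.{u}) : LimitCone (pair X Y) where
  cone := BinaryFan.mk (P := (⟨X × Y⟩ : FS.{u}))
    (⟨Prod.fst, fun _ hc => hc.1⟩ : SmoothMap (X × Y) X)
    (⟨Prod.snd, fun _ hc => hc.2⟩ : SmoothMap (X × Y) Y)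
  isLimit := BinaryFan.isLimitMk
    (fun s => (⟨fun z => (s.fst z, s.snd z),
      fun c hc => ⟨SmoothMap.smooth s.fst c hc, SmoothMap.smooth s.snd c hc⟩⟩ :
        SmoothMap s.pt (X × Y)))
    (fun _ => rfl) (fun _ => rfl)
    (fun _ _ h₁ h₂ => SmoothMap.ext <| funext fun z =>
      Prod.ext (congrArg (fun f : SmoothMap _ X => f z) h₁)
        (congrArg (fun f : SmoothMap _ Y => f z) h₂))

/-- `X ⊗ Y` is the product space on `X × Y`, and `𝟙_ FS` is the one-point space. -/
instance : CartesianMonoidalCategory FS.{u} :=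
  CartesianMonoidalCategory.ofChosenFiniteProducts terminalCone prodCone

/-- The function space `X^Y`. -/
abbrev exp (Y X : FS.{u}) : FS.{u} := ⟨SmoothMap Y X⟩

/-- The bifunctor `(Y, X) ↦ X^Y`. -/
def expFunctor : FS.{u}ᵒᵖ ⥤ FS.{u} ⥤ FS.{u} where
  obj Y :=
    { obj := fun X => exp Y.unop X
      map := fun {X X'} g =>
        (⟨fun f => SmoothMap.comp g f, SmoothMap.isSmooth_comp_left g⟩ :
          SmoothMap (exp Y.unop X) (exp Y.unop X')) }
  map {Y Y'} h :=
    { app := fun X =>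
        (⟨fun f => SmoothMap.comp f h.unop, SmoothMap.isSmooth_comp_right h.unop⟩ :
          SmoothMap (exp Y.unop X) (exp Y'.unop X)) }

end FS

/-! ### Weil algebras -/

/-- A Weil algebra: a finite-dimensional commutative `ℝ`-algebra `W` with an augmentation
`ε : W → ℝ` whose kernel consists of nilpotent elements, that is, `W = ℝ ⊕ 𝔪` is local with
residue field `ℝ` and nilpotent maximal ideal `𝔪`. -/
def isWeil : ObjectProperty (CommAlgCat.{0} ℝ) := fun W =>
  Module.Finite ℝ W ∧ ∃ ε : W →ₐ[ℝ] ℝ, ∀ x : W, ε x = 0 → IsNilpotent x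

/-- The category of Weil algebras and `ℝ`-algebra homomorphisms. -/
abbrev WeilAlg := isWeil.FullSubcategory

theorem isWeil_tensor {V W : CommAlgCat.{0} ℝ} (hV : isWeil V) (hW : isWeil W) :
    isWeil (V ⊗ W) := by
  obtain ⟨fV, εV, hεV⟩ := hV
  obtain ⟨fW, εW, hεW⟩ := hW
  have nilV : ∀ x : V, IsNilpotent (x - algebraMap ℝ V (εV x)) := fun x => hεV _ (by simp)
  have nilW : ∀ x : W, IsNilpotent (x - algebraMap ℝ W (εW x)) := fun x => hεW _ (by simp)
  change Module.Finite ℝ (V ⊗[ℝ] W) ∧ ∃ ε : V ⊗[ℝ] W →ₐ[ℝ] ℝ, ∀ x, ε x = 0 → IsNilpotent x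
  refine ⟨inferInstance, Algebra.TensorProduct.lift εV εW fun _ _ => .all _ _, fun z hz => ?_⟩
  set ε : V ⊗[ℝ] W →ₐ[ℝ] ℝ := Algebra.TensorProduct.lift εV εW fun _ _ => .all _ _
  have key : ∀ z : V ⊗[ℝ] W, IsNilpotent (z - algebraMap ℝ _ (ε z)) := by
    intro z
    induction z using TensorProduct.induction_on with
    | zero => simp
    | tmul x y =>
      have h1 : IsNilpotent ((x - algebraMap ℝ V (εV x)) ⊗ₜ[ℝ] y) := by
        obtain ⟨k, hk⟩ := nilV x
        exact ⟨k, by rw [Algebra.TensorProduct.tmul_pow, hk, TensorProduct.zero_tmul]⟩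
      have h2 : IsNilpotent ((algebraMap ℝ V (εV x)) ⊗ₜ[ℝ] (y - algebraMap ℝ W (εW y))) := by
        obtain ⟨k, hk⟩ := nilW y
        exact ⟨k, by rw [Algebra.TensorProduct.tmul_pow, hk, TensorProduct.tmul_zero]⟩
      have h3 := (Commute.all _ _).isNilpotent_add h1 h2
      have e : x ⊗ₜ[ℝ] y - algebraMap ℝ (V ⊗[ℝ] W) (ε (x ⊗ₜ y)) =
          (x - algebraMap ℝ V (εV x)) ⊗ₜ[ℝ] y +
            (algebraMap ℝ V (εV x)) ⊗ₜ[ℝ] (y - algebraMap ℝ W (εW y)) := by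
        have : ε (x ⊗ₜ y) = εV x * εW y := by simp [ε]
        rw [this, TensorProduct.sub_tmul, TensorProduct.tmul_sub,
          Algebra.algebraMap_eq_smul_one, Algebra.algebraMap_eq_smul_one,
          Algebra.algebraMap_eq_smul_one, Algebra.TensorProduct.one_def,
          TensorProduct.smul_tmul', TensorProduct.tmul_smul, TensorProduct.smul_tmul',
          smul_smul, mul_comm (εW y)]
        abel
      rw [e]
      exact h3
    | add x y hx hy =>
      have := (Commute.all _ _).isNilpotent_add hx hy
      rwa [show x + y - algebraMap ℝ (V ⊗[ℝ] W) (ε (x + y)) =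
        (x - algebraMap ℝ _ (ε x)) + (y - algebraMap ℝ _ (ε y)) by rw [map_add, map_add]; abel]
  simpa [hz] using key z

/-- Weil algebras are closed under tensor products (`⊗_∞` of Weil algebras is the algebraic tensor
product, as they are finite-dimensional) and contain `ℝ`. -/
instance : isWeil.IsMonoidal where
  prop_unit := by
    change Module.Finite ℝ ℝ ∧ ∃ ε : ℝ →ₐ[ℝ] ℝ, ∀ x, ε x = 0 → IsNilpotent x
    exact ⟨inferInstance, AlgHom.id ℝ ℝ, fun x hx => by
      rw [show x = 0 from hx]; exact IsNilpotent.zero⟩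
  prop_tensor _ _ := isWeil_tensor

/-! ### Weil prolongation -/

section Taylor

variable {V W : Type} [CommRing V] [Algebra ℝ V] [CommRing W] [Algebra ℝ W] {n : ℕ}

/-- The homogeneous part of degree `k` of the Taylor expansion at `0` of `h : ℝⁿ → ℝ`, evaluated at
`a₁, …, aₙ ∈ W`. -/
def taylorTerm (h : (Fin n → ℝ) → ℝ) (a : Fin n → W) (k : ℕ) : W :=
  (k.factorial : ℝ)⁻¹ • ∑ i : Fin k → Fin n,
    iteratedFDeriv ℝ k h 0 (fun j => Pi.single (i j) (1 : ℝ)) • ∏ j, a (i j)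

/-- The value `h(a) ∈ W` of a smooth function `h : ℝⁿ → ℝ` at nilpotent elements `a₁, …, aₙ` of
`W`, given by the Taylor expansion of `h` at `0`, which has only finitely many nonzero terms at
`a`. The map `h ↦ h(a)` is the homomorphism `C^∞(ℝⁿ) → W` that sends the coordinates to the
`aᵢ`. -/
def taylorEval (h : (Fin n → ℝ) → ℝ) (a : Fin n → W) : W := ∑ᶠ k, taylorTerm h a k

theorem taylorTerm_support_finite (h : (Fin n → ℝ) → ℝ) {a : Fin n → W}
    (ha : ∀ i, IsNilpotent (a i)) : (Function.support (taylorTerm h a)).Finite := by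
  have hI : IsNilpotent (Ideal.span (Set.range a)) := by
    refine (Ideal.FG.isNilpotent_iff_le_nilradical
      ⟨(Set.finite_range a).toFinset, by simp⟩).2 (Ideal.span_le.2 ?_)
    rintro _ ⟨i, rfl⟩
    exact ha i
  obtain ⟨N, hN⟩ := hI
  refine (Set.finite_lt_nat N).subset fun k hk => ?_
  by_contra hlt
  refine hk ?_
  have hz : ∀ i : Fin k → Fin n, ∏ j, a (i j) = 0 := fun i => by
    have h1 : ∏ j, a (i j) ∈ ∏ _j : Fin k, Ideal.span (Set.range a) :=
      Ideal.prod_mem_prod fun j _ => Ideal.subset_span ⟨i j, rfl⟩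
    rw [Finset.prod_const, Finset.card_univ, Fintype.card_fin] at h1
    have h2 := Ideal.pow_le_pow_right (not_lt.1 hlt) h1
    rw [hN] at h2
    exact h2
  simp [taylorTerm, hz]

theorem map_taylorTerm (φ : V →ₐ[ℝ] W) (h : (Fin n → ℝ) → ℝ) (a : Fin n → V) (k : ℕ) :
    φ (taylorTerm h a k) = taylorTerm h (φ ∘ a) k := by
  simp [taylorTerm, map_sum, map_prod]

theorem map_taylorEval (φ : V →ₐ[ℝ] W) (h : (Fin n → ℝ) → ℝ) {a : Fin n → V}
    (ha : ∀ i, IsNilpotent (a i)) : φ (taylorEval h a) = taylorEval h (φ ∘ a) := by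
  unfold taylorEval
  exact (AddMonoidHom.map_finsum (φ : V →+ W) (taylorTerm_support_finite h ha)).trans
    (finsum_congr fun k => map_taylorTerm φ h a k)

end Taylor

/-- A representative of a point of `X ⊗ W`: nilpotent elements `a₁, …, aₙ ∈ W` and a smooth map
`f : ℝⁿ → X`. -/
structure WeilRep (X : Type u) [Frolicher X] (W : Type) [CommRing W] where
  n : ℕ
  a : Fin n → W
  nil : ∀ i, IsNilpotent (a i)
  f : SmoothMap (Fin n → ℝ) X

/-- Two representatives `(a, f)` and `(b, g)` are equivalent if `f(0) = g(0)` and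
`(χ ∘ f)(a) = (χ ∘ g)(b)` in `W` for every structure function `χ` of `X`.

For a presentation `W = C^∞(ℝⁿ)/I`, let `a` be the tuple of the classes of the coordinates, so that
`I = {h | h(a) = 0}`: every point of `X ⊗ W` has a representative `(a, f)`, and `(a, f)`, `(a, g)`
are equivalent iff `f(0) = g(0)` and `χ ∘ f - χ ∘ g ∈ I` for every `χ`. -/
instance weilSetoid (X : Type u) [Frolicher X] (W : Type) [CommRing W] [Algebra ℝ W] :
    Setoid (WeilRep X W) where
  r p q := p.f 0 = q.f 0 ∧ ∀ χ ∈ functions (X := X),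
    taylorEval (fun x => χ (p.f x)) p.a = taylorEval (fun x => χ (q.f x)) q.a
  iseqv :=
    { refl := fun _ => ⟨rfl, fun _ _ => rfl⟩
      symm := fun h => ⟨h.1.symm, fun χ hχ => (h.2 χ hχ).symm⟩
      trans := fun h h' => ⟨h.1.trans h'.1, fun χ hχ => (h.2 χ hχ).trans (h'.2 χ hχ)⟩ }

/-- The underlying set of the Weil prolongation `X ⊗ W`. -/
def WeilProl (X : Type u) [Frolicher X] (W : Type) [CommRing W] [Algebra ℝ W] : Type u :=
  Quotient (weilSetoid X W)

namespace WeilProl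

variable {X : Type u} [Frolicher X] {Y : Type v} [Frolicher Y]
  {V W : Type} [CommRing V] [Algebra ℝ V] [CommRing W] [Algebra ℝ W]

/-- The canonical map `C^∞(ℝⁿ, X) → X ⊗ W` given by nilpotent elements `a₁, …, aₙ` of `W`. -/
def mk {n : ℕ} (a : Fin n → W) (ha : ∀ i, IsNilpotent (a i)) (f : SmoothMap (Fin n → ℝ) X) :
    WeilProl X W :=
  Quotient.mk _ ⟨n, a, ha, f⟩

/-- `X ⊗ W` has the quotient structure: it is generated by the images of the curves in
`C^∞(ℝⁿ, X)`. -/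
instance instFrolicher (X : Type u) [Frolicher X] (W : Type) [CommRing W] [Algebra ℝ W] :
    Frolicher (WeilProl X W) :=
  ofCurves {c | ∃ (n : ℕ) (a : Fin n → W) (ha : ∀ i, IsNilpotent (a i)),
    ∃ γ ∈ curves (X := SmoothMap (Fin n → ℝ) X), c = mk a ha ∘ γ}

/-- The action `X ⊗ W → Y ⊗ W` of a smooth map `X → Y`. -/
def mapLeft (g : SmoothMap X Y) : SmoothMap (WeilProl X W) (WeilProl Y W) where
  toFun := Quotient.map (fun p => ⟨p.n, p.a, p.nil, g.comp p.f⟩) fun _ _ h =>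
    ⟨congrArg g h.1, fun _ hχ => h.2 _ (g.smooth.comp_mem_functions hχ)⟩
  smooth := isSmooth_ofCurves _ <| by
    rintro _ ⟨n, a, ha, γ, hγ, rfl⟩
    exact mem_ofCurves ⟨n, a, ha, _, SmoothMap.isSmooth_comp_left g γ hγ, rfl⟩

/-- The action `X ⊗ V → X ⊗ W` of an algebra homomorphism `V → W`. -/
def mapRight (φ : V →ₐ[ℝ] W) : SmoothMap (WeilProl X V) (WeilProl X W) where
  toFun := Quotient.map (fun p => ⟨p.n, φ ∘ p.a, fun i => (p.nil i).map φ, p.f⟩) fun p q h =>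
    ⟨h.1, fun χ hχ => by
      have := congrArg φ (h.2 χ hχ)
      rwa [map_taylorEval φ _ p.nil, map_taylorEval φ _ q.nil] at this⟩
  smooth := isSmooth_ofCurves _ <| by
    rintro _ ⟨n, a, ha, γ, hγ, rfl⟩
    exact mem_ofCurves ⟨n, φ ∘ a, fun i => (ha i).map φ, γ, hγ, rfl⟩

end WeilProl

namespace FS

/-- The Weil prolongation bifunctor `(X, W) ↦ X ⊗ W`. -/
def weil : FS.{u} ⥤ WeilAlg ⥤ FS.{u} where
  obj X :=
    { obj := fun W => ⟨WeilProl X W.obj⟩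
      map := fun φ => WeilProl.mapRight φ.hom.hom
      map_id := fun _ => SmoothMap.ext <| funext <| by rintro ⟨_⟩; rfl
      map_comp := fun _ _ => SmoothMap.ext <| funext <| by rintro ⟨_⟩; rfl }
  map g :=
    { app := fun _ => WeilProl.mapLeft g
      naturality := fun _ _ _ => SmoothMap.ext <| funext <| by rintro ⟨_⟩; rfl }
  map_id _ := NatTrans.ext <| funext fun _ => SmoothMap.ext <| funext <| by rintro ⟨_⟩; rfl
  map_comp _ _ := NatTrans.ext <| funext fun _ => SmoothMap.ext <| funext <| by rintro ⟨_⟩; rfl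

/-! ### Weil exponentiability and microlinearity -/

/-- The functor `(Y, W₁, W₂) ↦ (X ⊗ (W₁ ⊗ W₂))^Y`. -/
def expOfWeil (X : FS.{u}) : FS.{u}ᵒᵖ × (WeilAlg × WeilAlg) ⥤ FS.{u} :=
  (𝟭 FS.{u}ᵒᵖ).prod (tensor WeilAlg ⋙ weil.obj X) ⋙ Functor.uncurry.obj expFunctor

/-- The functor `(Y, W₁, W₂) ↦ (X ⊗ W₁)^Y ⊗ W₂`. -/
def weilOfExp (X : FS.{u}) : FS.{u}ᵒᵖ × (WeilAlg × WeilAlg) ⥤ FS.{u} :=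
  prod.inverseAssociator _ _ _ ⋙
    ((𝟭 FS.{u}ᵒᵖ).prod (weil.obj X) ⋙ Functor.uncurry.obj expFunctor).prod (𝟭 WeilAlg) ⋙
      Functor.uncurry.obj weil

/-- `X` is Weil exponentiable if `(X ⊗ (W₁ ⊗ W₂))^Y ≅ (X ⊗ W₁)^Y ⊗ W₂` naturally in the Frölicher
space `Y` and the Weil algebras `W₁` and `W₂`. -/
def WeilExponentiable (X : FS.{u}) : Prop := Nonempty (expOfWeil X ≅ weilOfExp X)

/-- `X` is microlinear if `X ⊗ (·)` sends every finite limit diagram of Weil algebras to a limit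
diagram of Frölicher spaces. A finite limit diagram of Weil algebras is a cone of Weil algebras over
a finite diagram of Weil algebras that is a limit of `ℝ`-algebras. -/
def Microlinear (X : FS.{u}) : Prop :=
  ∀ (J : Type) [SmallCategory J] [FinCategory J] (D : J ⥤ WeilAlg) (c : Cone D),
    Nonempty (IsLimit (isWeil.ι.mapCone c)) → Nonempty (IsLimit ((weil.obj X).mapCone c))

/-- The property of being Weil exponentiable and microlinear. -/
def isWEML : ObjectProperty FS.{u} := fun X => WeilExponentiable X ∧ Microlinear X

/-- The category `FS_{WE,ML}`: the full subcategory of `FS` on the Weil exponentiable and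
microlinear Frölicher spaces. -/
abbrev WEML := isWEML.{u}.FullSubcategory

end FS

end

open Frolicher

/-! Apart from three analytic facts the proof is formal.

The first is Boman's theorem (`contDiff_of_contDiff_comp_curve`): a function on a finite-dimensional
space that is smooth along smooth curves is smooth. Suitable special curves force line derivatives
of every order to be locally bounded; after a cutoff, pure line derivatives in an orthonormal frame
control the decay of the Fourier transform, and Fourier inversion gives smoothness.

The second is that function spaces acquire no curves beyond the generating ones
(`SmoothMap.isSmooth_uncurry_of_mem_curves`). This reduces to C^∞(ℝ, ℝ), where the functionals g ↦ ∑
a_s g^(m)(s) with absolutely summable a are structure functions, and Banach–Steinhaus on ℓ¹ turns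
weak smoothness into local bounds on derivatives. Smoothness of evaluation, and with it the
exponential adjunction, follows.

The third is (X × Y) ⊗ W ≅ (X ⊗ W) × (Y ⊗ W). Injectivity is the delicate point, as structure
functions of X × Y do not come from the factors. Taylor evaluation at nilpotents is written as the
exponential of a nilpotent operator ∑ aᵢ∂ᵢ; these operators commute, so the two components can be
exchanged one at a time (`WeilProl.mapLeft_fst_snd_injective`).

Products now inherit both properties, because prolongation and (·)^Y preserve binary products. For
X^Y, taking W₁ = ℝ in Weil exponentiability yields X^Y ⊗ W ≅ (X ⊗ W)^Y. Microlinearity follows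
because (·)^Y is a right adjoint, and Weil exponentiability from (X^Y ⊗ W)^Z ≅ (X ⊗ W)^(Y × Z). The
one-point space is immediate. -/

noncomputable section

/-! ### Smoothness from bounded line derivatives, by Fourier analysis -/

open MeasureTheory Filter Topology in
/-- Line derivatives of all orders of a compactly supported function are compactly supported. -/
theorem tsupport_subset_of_hasLineDerivAt {V : Type*} [NormedAddCommGroup V] [NormedSpace ℝ V]
    {f g : V → ℂ} {v : V} (h : ∀ x, HasLineDerivAt ℝ f (g x) x v) :
    tsupport g ⊆ tsupport f := by
  refine closure_minimal (fun x hx => ?_) (isClosed_tsupport f)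
  by_contra hxf
  have h0 : f =ᶠ[𝓝 x] fun _ => 0 := notMem_tsupport_iff_eventuallyEq.1 hxf
  have h1 : HasLineDerivAt ℝ (fun _ : V => (0 : ℂ)) (g x) x v :=
    (h x).congr_of_eventuallyEq h0.symm
  have h2 : HasLineDerivAt ℝ (fun _ : V => (0 : ℂ)) 0 x v := by
    simpa [HasLineDerivAt] using hasDerivAt_const (0 : ℝ) (0 : ℂ)
  exact hx (HasDerivAt.unique h1 h2)

-- The derivative `g` is a pointwise limit of difference quotients with steps 1/(n+1). It need not
-- be continuous, so this is the source of measurability, and hence of integrability, of the higher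
-- line derivatives.
open MeasureTheory Filter Topology in
theorem measurable_of_hasLineDerivAt {V : Type*} [NormedAddCommGroup V] [NormedSpace ℝ V]
    [MeasurableSpace V] [BorelSpace V] {f g : V → ℂ} {v : V} (hf : Measurable f)
    (h : ∀ x, HasLineDerivAt ℝ f (g x) x v) : Measurable g := by
  have hlim : ∀ x, Tendsto (fun n : ℕ => ((1 / ((n : ℝ) + 1))⁻¹ : ℝ) •
      (f (x + (1 / ((n : ℝ) + 1)) • v) - f x)) atTop (𝓝 (g x)) := by
    intro x
    have h1 := HasDerivAt.tendsto_slope_zero (h x)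
    have h2 : Tendsto (fun n : ℕ => 1 / ((n : ℝ) + 1)) atTop (𝓝[≠] 0) := by
      refine tendsto_nhdsWithin_iff.2 ⟨tendsto_one_div_add_atTop_nhds_zero_nat, ?_⟩
      filter_upwards with n
      exact (Nat.one_div_pos_of_nat).ne'
    simpa [Function.comp_def] using h1.comp h2
  refine measurable_of_tendsto_metrizable (fun n => ?_) (tendsto_pi_nhds.2 hlim)
  exact Measurable.const_smul (c := ((1 / ((n : ℝ) + 1))⁻¹ : ℝ))
    ((hf.comp (measurable_id.add_const _)).sub hf)

-- Integration by parts against the character exp(-2πi⟨x, ξ⟩), which is an eigenfunction of the line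
-- derivative and has modulus 1, so that all integrands stay integrable.
open MeasureTheory Filter Topology FourierTransform Real in
theorem fourier_of_hasLineDerivAt {V : Type*} [NormedAddCommGroup V] [InnerProductSpace ℝ V]
    [FiniteDimensional ℝ V] [MeasurableSpace V] [BorelSpace V] {f g : V → ℂ} {v : V}
    (hf : Integrable f) (hg : Integrable g) (h : ∀ x, HasLineDerivAt ℝ f (g x) x v) (ξ : V) :
    𝓕 g ξ = (2 * π * inner ℝ v ξ * Complex.I : ℂ) * 𝓕 f ξ := by
  set e : V → ℂ := fun x => Complex.exp (↑(-2 * π * inner ℝ x ξ) * Complex.I) with he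
  set c : ℂ := -(2 * π * inner ℝ v ξ * Complex.I : ℂ) with hc
  have hcont : Continuous e := by fun_prop
  have hnorm : ∀ x, ‖e x‖ = 1 := fun x => Complex.norm_exp_ofReal_mul_I _
  have hder : ∀ x, HasLineDerivAt ℝ e (c * e x) x v := by
    intro x
    have h1 : HasDerivAt
        (fun t : ℝ => (↑(-2 * π * inner ℝ (x + t • v) ξ) * Complex.I : ℂ)) c 0 := by
      have h2 : HasDerivAt (fun t : ℝ => (-2 * π * inner ℝ (x + t • v) ξ)) (-2 * π * inner ℝ v ξ)
          0 := by
        simp only [inner_add_left, inner_smul_left]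
        simpa using (((hasDerivAt_id (0 : ℝ)).mul_const (inner ℝ v ξ)).const_add
          (inner ℝ x ξ)).const_mul (-2 * π)
      have h3 := h2.ofReal_comp.mul_const Complex.I
      have h4 : (↑(-2 * π * inner ℝ v ξ) * Complex.I : ℂ) = c := by rw [hc]; push_cast; ring
      rwa [h4] at h3
    have h4 := h1.cexp
    simp only [zero_smul, add_zero] at h4
    rw [mul_comm _ c] at h4
    exact h4
  have int1 : ∀ {k : V → ℂ}, Integrable k → Integrable (fun x => k x * e x) := fun hk =>
    hk.mul_bdd (c := 1) hcont.aestronglyMeasurable (ae_of_all _ fun x => (hnorm x).le)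
  have key := integral_bilinear_hasLineDerivAt_right_eq_neg_left_of_integrable
    (μ := volume) (f := f) (f' := g) (g := e) (g' := fun x => c * e x) (v := v)
    (B := ContinuousLinearMap.mul ℝ ℂ)
    (by simpa using int1 hg)
    (by simpa [mul_left_comm] using (int1 hf).const_mul c)
    (by simpa using int1 hf) (fun x _ => h x) (fun x _ => hder x)
  simp only [ContinuousLinearMap.mul_apply'] at key
  rw [Real.fourier_eq', Real.fourier_eq']
  simp only [smul_eq_mul]
  have e1 : ∫ x, f x * (c * e x) = c * ∫ x, f x * e x := by
    rw [← integral_const_mul]; congr 1; ext x; ring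
  rw [e1] at key
  simp only [he] at key
  simp only [mul_comm (Complex.exp _)]
  rw [hc] at key
  linear_combination key

open MeasureTheory Filter Topology FourierTransform Real in
/-- A compactly supported continuous function whose pure line derivatives in the directions of an
orthonormal basis exist to all orders and are bounded is smooth, as its Fourier transform decays
rapidly. -/
theorem contDiff_of_bounded_lineDeriv {V ι : Type*} [NormedAddCommGroup V] [InnerProductSpace ℝ V]
    [FiniteDimensional ℝ V] [Fintype ι] (b : OrthonormalBasis ι ℝ V) {f : V → ℂ}
    (hsupp : HasCompactSupport f) (hcont : Continuous f) (D : ι → ℕ → V → ℂ)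
    (hD0 : ∀ i, D i 0 = f)
    (hD : ∀ i j x, HasLineDerivAt ℝ (D i j) (D i (j + 1) x) x (b i))
    (hbd : ∀ i j, ∃ C, ∀ x, ‖D i j x‖ ≤ C) : ContDiff ℝ ∞ f := by
  borelize V
  have hmeas : ∀ i j, Measurable (D i j) := by
    intro i j
    induction j with
    | zero => rw [hD0]; exact hcont.measurable
    | succ j ih => exact measurable_of_hasLineDerivAt ih (hD i j)
  have hsub : ∀ i j, tsupport (D i j) ⊆ tsupport f := by
    intro i j
    induction j with
    | zero => rw [hD0]
    | succ j ih => exact (tsupport_subset_of_hasLineDerivAt (hD i j)).trans ih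
  have hint : ∀ i j, Integrable (D i j) := by
    intro i j
    obtain ⟨C, hC⟩ := hbd i j
    have : IntegrableOn (D i j) (tsupport f) :=
      Measure.integrableOn_of_bounded hsupp.isCompact.measure_lt_top.ne
        (hmeas i j).aestronglyMeasurable (M := C) (ae_of_all _ hC)
    exact (integrableOn_iff_integrable_of_support_subset
      ((subset_tsupport _).trans (hsub i j))).1 this
  have hfint : Integrable f := hcont.integrable_of_hasCompactSupport hsupp
  have hF : ∀ i j ξ, 𝓕 (D i j) ξ = (2 * π * inner ℝ (b i) ξ * Complex.I : ℂ) ^ j * 𝓕 f ξ := by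
    intro i j ξ
    induction j with
    | zero => simp [hD0]
    | succ j ih => rw [fourier_of_hasLineDerivAt (hint i j) (hint i (j + 1)) (hD i j), ih]; ring
  have hdec1 : ∀ i j, ∃ C, ∀ ξ, |inner ℝ (b i) ξ| ^ j * ‖𝓕 f ξ‖ ≤ C := by
    intro i j
    refine ⟨∫ x, ‖D i j x‖, fun ξ => ?_⟩
    have h1 : ‖𝓕 (D i j) ξ‖ ≤ ∫ x, ‖D i j x‖ :=
      VectorFourier.norm_fourierIntegral_le_integral_norm _ _ _ _ _
    refine le_trans ?_ h1
    rw [hF, norm_mul, norm_pow]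
    gcongr
    have : ‖(2 * π * inner ℝ (b i) ξ * Complex.I : ℂ)‖ = 2 * π * |inner ℝ (b i) ξ| := by
      simp [abs_of_pos pi_pos]
    rw [this]
    have : 1 ≤ 2 * π := by linarith [two_le_pi]
    nlinarith [abs_nonneg (inner ℝ (b i) ξ)]
  -- Pure powers of the coordinates suffice to bound ‖ξ‖ ^ j, since ‖ξ‖ is at most the sum of the
  -- |⟨bᵢ, ξ⟩|. The power mean inequality is available for the exponent j + 1; the way back to j is
  -- ‖ξ‖ ^ j ≤ 1 + ‖ξ‖ ^ (j + 1).
  have hdec2 : ∀ j, ∃ C, ∀ ξ, ‖ξ‖ ^ j * ‖𝓕 f ξ‖ ≤ C := by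
    intro j
    choose C hC using fun i => hdec1 i (j + 1)
    obtain ⟨C0, hC0⟩ : ∃ C, ∀ ξ, ‖𝓕 f ξ‖ ≤ C :=
      ⟨_, fun ξ => VectorFourier.norm_fourierIntegral_le_integral_norm _ _ _ _ _⟩
    refine ⟨C0 + (Fintype.card ι : ℝ) ^ j * ∑ i, C i, fun ξ => ?_⟩
    have h1 : ‖ξ‖ ≤ ∑ i, |inner ℝ (b i) ξ| := by
      conv_lhs => rw [← b.sum_repr' ξ]
      refine (norm_sum_le _ _).trans (Finset.sum_le_sum fun i _ => ?_)
      rw [norm_smul, b.norm_eq_one, mul_one, norm_eq_abs]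
    have h2 : ‖ξ‖ ^ (j + 1) * ‖𝓕 f ξ‖ ≤ (Fintype.card ι : ℝ) ^ j * ∑ i, C i := by
      have h3 : ‖ξ‖ ^ (j + 1) ≤ (Fintype.card ι : ℝ) ^ j * ∑ i, |inner ℝ (b i) ξ| ^ (j + 1) :=
        (pow_le_pow_left₀ (norm_nonneg _) h1 _).trans
          (by
            have h := pow_sum_div_card_le_sum_pow (s := Finset.univ)
              (f := fun i => |inner ℝ (b i) ξ|) (fun i _ => abs_nonneg _) j
            rcases isEmpty_or_nonempty ι with hι | hι
            · simp
            rw [div_le_iff₀ (by simp [Fintype.card_pos])] at h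
            rw [mul_comm]
            simpa using h)
      calc _ ≤ ((Fintype.card ι : ℝ) ^ j * ∑ i, |inner ℝ (b i) ξ| ^ (j + 1)) * ‖𝓕 f ξ‖ := by gcongr
        _ = (Fintype.card ι : ℝ) ^ j * ∑ i, |inner ℝ (b i) ξ| ^ (j + 1) * ‖𝓕 f ξ‖ := by
          rw [mul_assoc, Finset.sum_mul]
        _ ≤ _ := by gcongr with i; exact hC i ξ
    have h4 : ‖ξ‖ ^ j ≤ 1 + ‖ξ‖ ^ (j + 1) := by
      rcases le_total ‖ξ‖ 1 with h | h
      · have := pow_le_one₀ (n := j) (norm_nonneg ξ) h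
        have := pow_nonneg (norm_nonneg ξ) (j + 1)
        linarith
      · have := pow_le_pow_right₀ h (Nat.le_succ j)
        simp only [Nat.succ_eq_add_one] at this
        linarith
    calc _ ≤ (1 + ‖ξ‖ ^ (j + 1)) * ‖𝓕 f ξ‖ := by gcongr
      _ = ‖𝓕 f ξ‖ + ‖ξ‖ ^ (j + 1) * ‖𝓕 f ξ‖ := by ring
      _ ≤ _ := add_le_add (hC0 ξ) h2
  have hFcont : Continuous (𝓕 f) :=
    VectorFourier.fourierIntegral_continuous continuous_fourierChar
      (by exact continuous_inner) hfint
  have hFint : ∀ n : ℕ, Integrable (fun ξ => ‖ξ‖ ^ n * ‖𝓕 f ξ‖) := by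
    intro n
    -- Any exponent above the dimension makes (1 + ‖ξ‖)^(-M) integrable.
    set M := Module.finrank ℝ V + 1 with hM
    obtain ⟨C, hC⟩ := hdec2 n
    obtain ⟨C', hC'⟩ := hdec2 (M + n)
    have hI : Integrable fun ξ : V => (2 ^ (M - 1) * (C + C')) * (1 + ‖ξ‖) ^ (-(M : ℝ)) :=
      (integrable_one_add_norm (by simp [hM])).const_mul _
    refine hI.mono' (by fun_prop) (ae_of_all _ fun ξ => ?_)
    rw [norm_of_nonneg (by positivity), rpow_neg (by positivity), rpow_natCast,
      ← div_eq_mul_inv, le_div_iff₀ (by positivity)]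
    have h1 : (1 + ‖ξ‖) ^ M ≤ 2 ^ (M - 1) * (1 ^ M + ‖ξ‖ ^ M) :=
      add_pow_le (by norm_num) (norm_nonneg _) M
    calc _ ≤ ‖ξ‖ ^ n * ‖𝓕 f ξ‖ * (2 ^ (M - 1) * (1 ^ M + ‖ξ‖ ^ M)) := by gcongr
      _ = 2 ^ (M - 1) * (‖ξ‖ ^ n * ‖𝓕 f ξ‖ + ‖ξ‖ ^ (M + n) * ‖𝓕 f ξ‖) := by
        rw [one_pow, pow_add]; ring
      _ ≤ _ := by gcongr; exacts [hC ξ, hC' ξ]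
  have hFint0 : Integrable (𝓕 f) := by
    have := hFint 0
    simp only [pow_zero, one_mul] at this
    exact (integrable_norm_iff hFcont.aestronglyMeasurable).1 this
  have hinv := hcont.fourierInv_fourier_eq hfint hFint0
  rw [← hinv]
  have h1 : ContDiff ℝ ∞ (𝓕 (𝓕 f)) := contDiff_fourier (N := ⊤) fun n _ => hFint n
  -- Up to a reflection, `f` is thus the Fourier transform of a function all of whose moments are
  -- integrable.
  have h2 : 𝓕⁻ (𝓕 f) = fun x => 𝓕 (𝓕 f) (-x) := by
    ext x; exact fourierInv_eq_fourier_neg _ _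
  rw [h2]
  exact h1.comp contDiff_neg

/-! ### Line derivatives and the local form of the criterion -/

section LineDerivatives

open Filter Topology

variable {V : Type*} [NormedAddCommGroup V] [NormedSpace ℝ V]

/-- The line derivative of order `j` of `f` at `x` in the direction `v`. -/
def iteratedLineDeriv (f : V → ℝ) (v : V) (j : ℕ) (x : V) : ℝ :=
  iteratedDeriv j (fun r : ℝ => f (x + r • v)) 0

theorem iteratedLineDeriv_zero (f : V → ℝ) (v x : V) : iteratedLineDeriv f v 0 x = f x := by
  simp [iteratedLineDeriv]

theorem iteratedLineDeriv_add_smul (f : V → ℝ) (v : V) (j : ℕ) (x : V) (r : ℝ) :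
    iteratedLineDeriv f v j (x + r • v) = iteratedDeriv j (fun r : ℝ => f (x + r • v)) r := by
  have h := congrFun (iteratedDeriv_comp_const_add j (fun r : ℝ => f (x + r • v)) r) 0
  simp only [add_zero] at h
  rw [← h, iteratedLineDeriv]
  simp only [add_smul, add_assoc]

theorem hasLineDerivAt_iteratedLineDeriv {f : V → ℝ} {v x : V}
    (h : ContDiff ℝ ∞ fun r : ℝ => f (x + r • v)) (j : ℕ) :
    HasLineDerivAt ℝ (iteratedLineDeriv f v j) (iteratedLineDeriv f v (j + 1) x) x v := by
  unfold HasLineDerivAt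
  simp only [iteratedLineDeriv_add_smul]
  rw [iteratedLineDeriv, iteratedDeriv_succ]
  exact (h.differentiable_iteratedDeriv j
    (by exact_mod_cast ENat.natCast_lt_top j)).differentiableAt.hasDerivAt

theorem iteratedLineDeriv_smul {f : V → ℝ} {v x : V}
    (h : ContDiff ℝ ∞ fun r : ℝ => f (x + r • v)) (c : ℝ) (j : ℕ) :
    iteratedLineDeriv f (c • v) j x = c ^ j * iteratedLineDeriv f v j x := by
  have := congrFun (iteratedDeriv_comp_const_mul (h.of_le (by exact_mod_cast le_top) :
    ContDiff ℝ j fun r : ℝ => f (x + r • v)) c) 0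
  simp only [mul_zero] at this
  rw [iteratedLineDeriv, iteratedLineDeriv, ← this]
  simp only [smul_smul, mul_comm]

theorem iteratedLineDeriv_eq_zero {f : V → ℝ} {x : V} (hx : x ∉ tsupport f) (v : V) (j : ℕ) :
    iteratedLineDeriv f v j x = 0 := by
  have h0 : f =ᶠ[𝓝 x] fun _ => 0 := notMem_tsupport_iff_eventuallyEq.1 hx
  have h1 : Tendsto (fun r : ℝ => x + r • v) (𝓝 0) (𝓝 x) := by
    have : Continuous fun r : ℝ => x + r • v := by fun_prop
    simpa using this.tendsto 0
  have h2 : (fun r : ℝ => f (x + r • v)) =ᶠ[𝓝 0] fun _ => 0 := h1.eventually h0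
  rw [iteratedLineDeriv, h2.iteratedDeriv_eq]
  simp

/-- `f` is smooth on every line in the direction `v`, and its line derivatives of all orders in this
direction are locally bounded. -/
def IsLineSmooth (f : V → ℝ) (v : V) : Prop :=
  (∀ x, ContDiff ℝ ∞ fun r : ℝ => f (x + r • v)) ∧
    ∀ j x₀, ∃ C, ∀ᶠ x in 𝓝 x₀, |iteratedLineDeriv f v j x| ≤ C

/-- By the Leibniz formula, a line derivative of the product is a finite sum of products of locally
bounded functions. This is what permits cutoffs. -/
theorem IsLineSmooth.mul {f g : V → ℝ} {v : V} (hf : IsLineSmooth f v) (hg : IsLineSmooth g v) :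
    IsLineSmooth (fun x => f x * g x) v := by
  refine ⟨fun x => (hf.1 x).mul (hg.1 x), fun j x₀ => ?_⟩
  choose C hC using fun i => hf.2 i x₀
  choose C' hC' using fun i => hg.2 i x₀
  refine ⟨∑ i ∈ Finset.range (j + 1), j.choose i * C i * C' (j - i), ?_⟩
  have h1 : ∀ᶠ x in 𝓝 x₀, ∀ i ∈ Finset.range (j + 1), |iteratedLineDeriv f v i x| ≤ C i :=
    (eventually_all_finset _).2 fun i _ => hC i
  have h2 : ∀ᶠ x in 𝓝 x₀, ∀ i ∈ Finset.range (j + 1),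
      |iteratedLineDeriv g v (j - i) x| ≤ C' (j - i) :=
    (eventually_all_finset _).2 fun i _ => hC' _
  filter_upwards [h1, h2] with x h1 h2
  have h3 := iteratedDeriv_mul (n := j) (x := (0 : ℝ))
    ((hf.1 x).of_le (by exact_mod_cast le_top)).contDiffAt
    ((hg.1 x).of_le (by exact_mod_cast le_top)).contDiffAt
  have h4 : iteratedLineDeriv (fun x => f x * g x) v j x = ∑ i ∈ Finset.range (j + 1),
      j.choose i * iteratedLineDeriv f v i x * iteratedLineDeriv g v (j - i) x := h3
  rw [h4]
  refine (Finset.abs_sum_le_sum_abs _ _).trans (Finset.sum_le_sum fun i hi => ?_)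
  rw [abs_mul, abs_mul, Nat.abs_cast]
  have h5 := h1 i hi
  have h6 := h2 i hi
  have h7 := (abs_nonneg _).trans h5
  gcongr

theorem iteratedLineDeriv_succ' {f : V → ℝ} (hf : Differentiable ℝ f) (v : V) (j : ℕ) (x : V) :
    iteratedLineDeriv f v (j + 1) x = iteratedLineDeriv (fun y => fderiv ℝ f y v) v j x := by
  rw [iteratedLineDeriv, iteratedLineDeriv, iteratedDeriv_succ']
  congr 1
  ext r
  have h1 : HasDerivAt (fun r : ℝ => x + r • v) v r := by
    simpa using ((hasDerivAt_id r).smul_const v).const_add x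
  exact ((hf _).hasFDerivAt.comp_hasDerivAt r h1).deriv

theorem ContDiff.continuous_iteratedLineDeriv {f : V → ℝ} (hf : ContDiff ℝ ∞ f) (v : V) (j : ℕ) :
    Continuous (iteratedLineDeriv f v j) := by
  induction j generalizing f with
  | zero => simpa only [funext (iteratedLineDeriv_zero f v)] using hf.continuous
  | succ j ih =>
    simp only [funext (iteratedLineDeriv_succ' (hf.differentiable (by simp)) v j)]
    exact ih ((hf.fderiv_right (m := ∞) (by simp)).clm_apply contDiff_const)

theorem ContDiff.isLineSmooth {f : V → ℝ} (hf : ContDiff ℝ ∞ f) (v : V) : IsLineSmooth f v := by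
  refine ⟨fun x => hf.comp (by fun_prop), fun j x₀ => ?_⟩
  have h := ((hf.continuous_iteratedLineDeriv v j).abs.tendsto x₀).eventually
    (ge_mem_nhds (lt_add_one _))
  exact ⟨_, h⟩

end LineDerivatives

open Filter Topology in
/-- A continuous function whose pure line derivatives in the directions of an orthonormal basis
exist to all orders and are locally bounded is smooth. -/
theorem contDiff_of_isLineSmooth {V ι : Type*} [NormedAddCommGroup V] [InnerProductSpace ℝ V]
    [FiniteDimensional ℝ V] [Fintype ι] (b : OrthonormalBasis ι ℝ V) {f : V → ℝ}
    (hcont : Continuous f) (h : ∀ i, IsLineSmooth f (b i)) : ContDiff ℝ ∞ f := by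
  rw [contDiff_iff_contDiffAt]
  intro x₀
  -- The cutoff equals 1 near `x₀`, so `g` agrees with `f` there. Its compact support turns the
  -- local bounds on line derivatives into global ones.
  let ρ : ContDiffBump x₀ := ⟨1, 2, one_pos, one_lt_two⟩
  set g : V → ℝ := fun x => ρ x * f x with hg
  have hgs : ∀ i, IsLineSmooth g (b i) := fun i =>
    (ρ.contDiff.isLineSmooth (b i)).mul (h i)
  have hsupp : HasCompactSupport g := ρ.hasCompactSupport.mul_right
  have hgc : Continuous g := ρ.continuous.mul hcont
  have hbd : ∀ i j, ∃ C, ∀ x, |iteratedLineDeriv g (b i) j x| ≤ C := by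
    intro i j
    have h1 : ∃ C, ∀ x ∈ tsupport g, |iteratedLineDeriv g (b i) j x| ≤ C := by
      refine hsupp.isCompact.induction_on
        (p := fun s => ∃ C, ∀ x ∈ s, |iteratedLineDeriv g (b i) j x| ≤ C) ⟨0, by simp⟩
        (fun s t hst ⟨C, hC⟩ => ⟨C, fun x hx => hC x (hst hx)⟩) ?_ ?_
      · rintro s t ⟨C, hC⟩ ⟨C', hC'⟩
        refine ⟨max C C', ?_⟩
        rintro x (hx | hx)
        exacts [(hC x hx).trans (le_max_left _ _), (hC' x hx).trans (le_max_right _ _)]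
      · intro x _
        obtain ⟨C, hC⟩ := (hgs i).2 j x
        exact ⟨_, mem_nhdsWithin_of_mem_nhds hC, C, fun y hy => hy⟩
    obtain ⟨C, hC⟩ := h1
    refine ⟨max C 0, fun x => ?_⟩
    by_cases hx : x ∈ tsupport g
    · exact (hC x hx).trans (le_max_left _ _)
    · simp [iteratedLineDeriv_eq_zero hx]
  have key : ContDiff ℝ ∞ fun x => (g x : ℂ) := by
    refine contDiff_of_bounded_lineDeriv b
      (hsupp.comp_left (g := ((↑) : ℝ → ℂ)) (by simp)) (Complex.continuous_ofReal.comp hgc)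
      (fun i j x => (iteratedLineDeriv g (b i) j x : ℂ))
      (fun i => by ext x; simp [iteratedLineDeriv_zero])
      (fun i j x => ?_) (fun i j => ?_)
    · exact HasDerivAt.ofReal_comp (hasLineDerivAt_iteratedLineDeriv ((hgs i).1 x) j)
    · obtain ⟨C, hC⟩ := hbd i j
      exact ⟨C, fun x => by simpa using hC x⟩
  have hgsm : ContDiff ℝ ∞ g := Complex.reCLM.contDiff.comp key
  refine hgsm.contDiffAt.congr_of_eventuallyEq ?_
  filter_upwards [ρ.eventuallyEq_one] with x hx
  simp [hg, hx]

/-! ### Boman's theorem -/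

section Boman

open Filter Topology

variable {V : Type*} [NormedAddCommGroup V] [NormedSpace ℝ V]

/-- Each differentiation costs a factor 2^k in the k-th term, so the n-th derivative of that term is
at most C n * (2^n)^k / k!. The factorial decay of `w` makes this summable for every n. -/
theorem contDiff_tsum_dilate [CompleteSpace V] {ψ : ℝ → ℝ} (hψ : ContDiff ℝ ∞ ψ)
    (hsupp : HasCompactSupport ψ) {w : ℕ → V} (hw : ∀ k, ‖w k‖ ≤ 1 / (k.factorial : ℝ)) :
    ContDiff ℝ ∞ fun t : ℝ => ∑' k : ℕ, ψ (2 ^ k * t - 1) • w k := by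
  have hψ's : ContDiff ℝ ∞ fun t => ψ (t - 1) := hψ.comp (by fun_prop)
  have hb : ∀ n : ℕ, ∃ C, ∀ t, ‖iteratedDeriv n (fun t => ψ (t - 1)) t‖ ≤ C := by
    intro n
    have h1 : HasCompactSupport fun t => ψ (t - 1) :=
      hsupp.comp_homeomorph (Homeomorph.subRight (1 : ℝ))
    have h2 : HasCompactSupport (iteratedDeriv n fun t => ψ (t - 1)) := by
      induction n with
      | zero => simpa using h1
      | succ n ih => rw [iteratedDeriv_succ]; exact ih.deriv
    exact h2.exists_bound_of_continuous (hψ's.continuous_iteratedDeriv n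
      (by exact_mod_cast le_top))
  choose C hC using hb
  have hs : ∀ k : ℕ, ContDiff ℝ ∞ fun t : ℝ => ψ (2 ^ k * t - 1) := fun k =>
    hψ.comp (by fun_prop)
  have hbound : ∀ (n k : ℕ) (t : ℝ), ‖iteratedFDeriv ℝ n (fun t : ℝ => ψ (2 ^ k * t - 1) • w k) t‖ ≤
      C n * ((2 ^ n) ^ k / (k.factorial : ℝ)) := by
    intro n k t
    rw [norm_iteratedFDeriv_eq_norm_iteratedDeriv]
    have hle : ((n : ℕ∞) : WithTop ℕ∞) ≤ ∞ := by exact_mod_cast le_top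
    have h1 : iteratedDeriv n (fun t : ℝ => ψ (2 ^ k * t - 1)) t =
        (2 ^ k) ^ n * iteratedDeriv n (fun t => ψ (t - 1)) (2 ^ k * t) :=
      congrFun (iteratedDeriv_comp_const_mul (hψ's.of_le hle) (2 ^ k)) t
    rw [iteratedDeriv_smul_const ((hs k).of_le hle).contDiffAt, h1, norm_smul, norm_mul]
    have hp : ‖((2 : ℝ) ^ k) ^ n‖ = (2 ^ n) ^ k := by
      rw [Real.norm_of_nonneg (by positivity), ← pow_mul, ← pow_mul, mul_comm]
    have hC0 : 0 ≤ C n := (norm_nonneg _).trans (hC n 0)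
    rw [hp]
    calc _ ≤ ((2 : ℝ) ^ n) ^ k * C n * (1 / (k.factorial : ℝ)) :=
          mul_le_mul (mul_le_mul_of_nonneg_left (hC n _) (by positivity)) (hw k) (norm_nonneg _)
            (by positivity)
      _ = _ := by ring
  exact contDiff_tsum (N := ⊤) (fun k => (hs k).smul contDiff_const)
    (fun n _ => (Real.summable_pow_div_factorial _).mul_left _) fun n k t _ => hbound n k t

/-- A smooth curve that follows prescribed short line segments near the times `2⁻ᵏ`. -/
theorem exists_contDiff_curve [CompleteSpace V] (x : V) {y v : ℕ → V}
    (hy : ∀ k, ‖y k‖ ≤ 1 / (k.factorial : ℝ)) (hv : ∀ k, ‖v k‖ ≤ 1 / (k.factorial : ℝ)) :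
    ∃ c : ℝ → V, ContDiff ℝ ∞ c ∧
      ∀ k : ℕ, ∀ᶠ s : ℝ in 𝓝 0, c ((2 ^ k)⁻¹ + (2 ^ k)⁻¹ * s) = x + y k + s • v k := by
  -- The radii 1/8 and 1/4 isolate the k-th term: at t = 2^(-k)(1 + s) with |s| < 1/8, the argument
  -- 2^l t - 1 is s for l = k, at most -7/16 for l < k, and at least 3/4 for l > k.
  let φ : ContDiffBump (0 : ℝ) := ⟨1 / 8, 1 / 4, by norm_num, by norm_num⟩
  refine ⟨fun t => x + (∑' k : ℕ, φ (2 ^ k * t - 1) • y k +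
    ∑' k : ℕ, (φ (2 ^ k * t - 1) * (2 ^ k * t - 1)) • v k), ?_, fun k => ?_⟩
  · refine contDiff_const.add ((contDiff_tsum_dilate φ.contDiff φ.hasCompactSupport hy).add ?_)
    exact contDiff_tsum_dilate (ψ := fun s => φ s * s) (φ.contDiff.mul contDiff_id)
      φ.hasCompactSupport.mul_right hv
  · filter_upwards [Metric.ball_mem_nhds (0 : ℝ) (show (0 : ℝ) < 1 / 8 by norm_num)] with s hs
    have hs' : |s| < 1 / 8 := by simpa using hs
    have hk : (2 : ℝ) ^ k * ((2 ^ k)⁻¹ + (2 ^ k)⁻¹ * s) - 1 = s := by field_simp; ring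
    have hφs : φ s = 1 := φ.one_of_mem_closedBall
      (mem_closedBall_zero_iff.2 (show ‖s‖ ≤ 1 / 8 from hs'.le))
    have hne : ∀ l, l ≠ k → φ ((2 : ℝ) ^ l * ((2 ^ k)⁻¹ + (2 ^ k)⁻¹ * s) - 1) = 0 := by
      intro l hl
      refine φ.zero_of_le_dist ?_
      change (1 : ℝ) / 4 ≤ _
      rw [Real.dist_eq, sub_zero]
      have h2 := abs_lt.1 hs'
      rcases lt_or_gt_of_ne hl with h | h
      · obtain ⟨d, rfl⟩ := Nat.exists_eq_add_of_lt h
        have e : (2 : ℝ) ^ l * ((2 ^ (l + d + 1))⁻¹ + (2 ^ (l + d + 1))⁻¹ * s) - 1 =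
            (2 ^ d)⁻¹ / 2 * (1 + s) - 1 := by
          rw [pow_add, pow_add]; field_simp
        rw [e, le_abs]
        right
        have h3 : ((2 : ℝ) ^ d)⁻¹ ≤ 1 := inv_le_one_of_one_le₀ (one_le_pow₀ one_le_two)
        nlinarith
      · obtain ⟨d, rfl⟩ := Nat.exists_eq_add_of_lt h
        have e : (2 : ℝ) ^ (k + d + 1) * ((2 ^ k)⁻¹ + (2 ^ k)⁻¹ * s) - 1 =
            2 ^ d * 2 * (1 + s) - 1 := by
          rw [pow_add, pow_add]; field_simp
        rw [e, le_abs]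
        left
        have h3 : (1 : ℝ) ≤ 2 ^ d := one_le_pow₀ one_le_two
        nlinarith
    rw [tsum_eq_single k (fun l hl => by rw [hne l hl, zero_smul]),
      tsum_eq_single k (fun l hl => by rw [hne l hl, zero_mul, zero_smul]), hk, hφs]
    simp [add_assoc]

/-- Near t = 2^(-k) the special curve `c` runs along the line through x + y k in the direction v k.
The line derivative is therefore 2^(-kj) times the j-th derivative of f ∘ c at 2^(-k), and all these
times lie in [0, 1]. -/
theorem exists_bound_iteratedLineDeriv_seq [CompleteSpace V] {f : V → ℝ}
    (hf : ∀ c : ℝ → V, ContDiff ℝ ∞ c → ContDiff ℝ ∞ (f ∘ c)) (x : V) {y v : ℕ → V}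
    (hy : ∀ k, ‖y k‖ ≤ 1 / (k.factorial : ℝ)) (hv : ∀ k, ‖v k‖ ≤ 1 / (k.factorial : ℝ)) (j : ℕ) :
    ∃ M, ∀ k, |iteratedLineDeriv f (v k) j (x + y k)| ≤ M := by
  obtain ⟨c, hc, hck⟩ := exists_contDiff_curve x hy hv
  have hg := hf c hc
  have hle : ((j : ℕ∞) : WithTop ℕ∞) ≤ ∞ := by exact_mod_cast le_top
  obtain ⟨M, hM⟩ := (isCompact_Icc (a := (0 : ℝ)) (b := 1)).exists_bound_of_continuousOn
    (hg.continuous_iteratedDeriv j hle).continuousOn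
  refine ⟨M, fun k => ?_⟩
  have h1 : (fun s : ℝ => f (x + y k + s • v k)) =ᶠ[𝓝 0]
      fun s => (f ∘ c) ((2 ^ k)⁻¹ + (2 ^ k)⁻¹ * s) := by
    filter_upwards [hck k] with s hs
    simp [hs]
  have hg' : ContDiff ℝ ∞ fun t => (f ∘ c) ((2 ^ k)⁻¹ + t) := hg.comp (by fun_prop)
  have h2 := congrFun (iteratedDeriv_comp_const_mul (hg'.of_le hle) ((2 ^ k)⁻¹)) 0
  rw [iteratedDeriv_comp_const_add] at h2
  rw [iteratedLineDeriv, h1.iteratedDeriv_eq, h2, abs_mul]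
  have h3 : ((2 : ℝ) ^ k)⁻¹ ≤ 1 := inv_le_one_of_one_le₀ (one_le_pow₀ one_le_two)
  have h4 : (0 : ℝ) ≤ ((2 : ℝ) ^ k)⁻¹ := by positivity
  have h5 := hM ((2 ^ k)⁻¹ + (2 ^ k)⁻¹ * 0) (by rw [mul_zero, add_zero]; exact ⟨h4, h3⟩)
  calc _ ≤ 1 * M := by
        gcongr
        · rw [abs_of_nonneg (by positivity)]; exact pow_le_one₀ h4 h3
        · exact h5
    _ = M := one_mul _

theorem exists_bound_iteratedLineDeriv [CompleteSpace V] {f : V → ℝ}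
    (hf : ∀ c : ℝ → V, ContDiff ℝ ∞ c → ContDiff ℝ ∞ (f ∘ c)) (j : ℕ) (x₀ : V) :
    ∃ C, ∀ᶠ x in 𝓝 x₀, ∀ u : V, ‖u‖ ≤ 1 → |iteratedLineDeriv f u j x| ≤ C := by
  by_contra! hcon
  have h1 : ∀ k : ℕ, ∃ x u : V, ‖x - x₀‖ ≤ 1 / (k.factorial : ℝ) ∧ ‖u‖ ≤ 1 ∧
      -- The direction will be scaled to u k / k! to meet the decay condition on v, which divides
      -- the j-th line derivative by (k!)^j. The chosen size leaves more than k, contradicting the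
      -- bound along the sequence.
      k * (k.factorial : ℝ) ^ j < |iteratedLineDeriv f u j x| := by
    intro k
    have h2 := hcon (k * (k.factorial : ℝ) ^ j)
    obtain ⟨x, ⟨u, hu, hlt⟩, hx⟩ := (h2.and_eventually (Metric.closedBall_mem_nhds x₀
      (show 0 < 1 / (k.factorial : ℝ) by positivity))).exists
    exact ⟨x, u, by simpa [dist_eq_norm] using hx, hu, hlt⟩
  choose x u hx hu hlt using h1
  obtain ⟨M, hM⟩ := exists_bound_iteratedLineDeriv_seq hf x₀ (y := fun k => x k - x₀)
    (v := fun k => (1 / (k.factorial : ℝ)) • u k) hx (fun k => by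
      rw [norm_smul, Real.norm_of_nonneg (by positivity)]
      exact mul_le_of_le_one_right (by positivity) (hu k)) j
  obtain ⟨k, hk⟩ := exists_nat_gt M
  have h3 := hM k
  rw [add_sub_cancel, iteratedLineDeriv_smul (hf _ (by fun_prop)), abs_mul,
    abs_of_nonneg (by positivity)] at h3
  have h4 : (0 : ℝ) < (k.factorial : ℝ) ^ j := by positivity
  have h5 : (k : ℝ) < (1 / (k.factorial : ℝ)) ^ j * |iteratedLineDeriv f (u k) j (x k)| := by
    rw [one_div, inv_pow, inv_mul_eq_div, lt_div_iff₀ h4]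
    exact hlt k
  linarith

/-- First line derivatives are bounded near x₀ uniformly over unit directions, so the mean value
inequality on the segment from x₀ to x gives a Lipschitz estimate at x₀. -/
theorem continuous_of_contDiff_comp_curve [CompleteSpace V] {f : V → ℝ}
    (hf : ∀ c : ℝ → V, ContDiff ℝ ∞ c → ContDiff ℝ ∞ (f ∘ c)) : Continuous f := by
  rw [continuous_iff_continuousAt]
  intro x₀
  obtain ⟨C, hC⟩ := exists_bound_iteratedLineDeriv hf 1 x₀
  obtain ⟨δ, hδ, hball⟩ := Metric.eventually_nhds_iff_ball.1 hC
  have hline : ∀ x v : V, ContDiff ℝ ∞ fun r : ℝ => f (x + r • v) := fun x v =>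
    hf _ (by fun_prop)
  have hlip : ∀ x ∈ Metric.ball x₀ δ, |f x - f x₀| ≤ C * ‖x - x₀‖ := by
    intro x hx
    rcases eq_or_ne x x₀ with rfl | hne
    · simp
    have hn : 0 < ‖x - x₀‖ := norm_pos_iff.2 (sub_ne_zero.2 hne)
    set v := x - x₀ with hv
    have h1 : ∀ r ∈ Set.Icc (0 : ℝ) 1, ‖deriv (fun r : ℝ => f (x₀ + r • v)) r‖ ≤ C * ‖v‖ := by
      intro r hr
      have h2 : x₀ + r • v ∈ Metric.ball x₀ δ := by
        rw [mem_ball_iff_norm] at hx ⊢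
        rw [add_sub_cancel_left, norm_smul, Real.norm_of_nonneg hr.1]
        exact (mul_le_of_le_one_left (norm_nonneg _) hr.2).trans_lt hx
      have h3 := hball _ h2 (‖v‖⁻¹ • v) (by
        rw [norm_smul, norm_inv, norm_norm, inv_mul_cancel₀ hn.ne'])
      rw [iteratedLineDeriv_smul (hline _ _), iteratedLineDeriv_add_smul, iteratedDeriv_one,
        pow_one, abs_mul, abs_of_pos (inv_pos.2 hn), inv_mul_le_iff₀ hn] at h3
      rw [Real.norm_eq_abs, mul_comm]
      exact h3
    have h4 := (convex_Icc (0 : ℝ) 1).norm_image_sub_le_of_norm_deriv_le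
      (fun r _ => ((hline x₀ v).differentiable (by simp)).differentiableAt) h1
      (Set.left_mem_Icc.2 zero_le_one) (Set.right_mem_Icc.2 zero_le_one)
    simpa [hv] using h4
  have h5 : Tendsto (fun x => C * ‖x - x₀‖) (𝓝 x₀) (𝓝 0) := by
    have : Continuous fun x => C * ‖x - x₀‖ := by fun_prop
    simpa using this.tendsto x₀
  rw [ContinuousAt, tendsto_iff_dist_tendsto_zero]
  refine squeeze_zero' (Eventually.of_forall fun _ => dist_nonneg) ?_ h5
  filter_upwards [Metric.ball_mem_nhds x₀ hδ] with x hx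
  exact hlip x hx

/-- **Boman's theorem**: a function on a finite-dimensional space that is smooth along all smooth
curves is smooth. -/
theorem contDiff_of_contDiff_comp_curve [FiniteDimensional ℝ V] {f : V → ℝ}
    (hf : ∀ c : ℝ → V, ContDiff ℝ ∞ c → ContDiff ℝ ∞ (f ∘ c)) : ContDiff ℝ ∞ f := by
  let e : V ≃L[ℝ] EuclideanSpace ℝ (Fin (Module.finrank ℝ V)) := toEuclidean
  have hg : ∀ c : ℝ → EuclideanSpace ℝ (Fin (Module.finrank ℝ V)), ContDiff ℝ ∞ c →
      ContDiff ℝ ∞ ((f ∘ e.symm) ∘ c) := fun c hc => hf _ (e.symm.contDiff.comp hc)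
  have h : ContDiff ℝ ∞ (f ∘ e.symm) := by
    refine contDiff_of_isLineSmooth (EuclideanSpace.basisFun _ ℝ)
      (continuous_of_contDiff_comp_curve hg) fun i => ⟨fun x => hg _ (by fun_prop), fun j x₀ => ?_⟩
    obtain ⟨C, hC⟩ := exists_bound_iteratedLineDeriv hg j x₀
    refine ⟨C, hC.mono fun x hx => hx _ (by simp)⟩
  simpa [Function.comp_def] using h.comp e.contDiff

end Boman

/-! ### Weakly smooth curves in C^∞(ℝ, ℝ) are jointly smooth -/

section ExponentialLawReal

open Filter Topology

/-- For j = 0 this is Banach–Steinhaus on a compact interval. The pointwise derivative of `L` is a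
limit of difference quotients of continuous functionals, hence itself a family of continuous
functionals, so the argument can be iterated. -/
theorem exists_bound_iteratedDeriv_of_pointwise {E : Type*} [NormedAddCommGroup E]
    [NormedSpace ℝ E] [CompleteSpace E] {L : ℝ → E →L[ℝ] ℝ}
    (hL : ∀ a, ContDiff ℝ ∞ fun t => L t a) (j : ℕ) (R : ℝ) :
    ∃ C, ∀ t ∈ Set.Icc (-R) R, ∀ a, |iteratedDeriv j (fun t => L t a) t| ≤ C * ‖a‖ := by
  induction j generalizing L with
  | zero =>
    obtain ⟨C, hC⟩ := banach_steinhaus (g := fun t : Set.Icc (-R) R => L t) fun a => by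
      obtain ⟨M, hM⟩ := (isCompact_Icc (a := -R) (b := R)).exists_bound_of_continuousOn
        (hL a).continuous.continuousOn
      exact ⟨M, fun t => hM t t.2⟩
    refine ⟨C, fun t ht a => ?_⟩
    rw [iteratedDeriv_zero]
    exact (L t).le_of_opNorm_le (hC ⟨t, ht⟩) a
  | succ j ih =>
    have hlim : ∀ t, Tendsto (fun (n : ℕ) (a : E) =>
        (((1 / ((n : ℝ) + 1))⁻¹ : ℝ) • (L (t + 1 / ((n : ℝ) + 1)) - L t)) a) atTop
        (𝓝 fun a => deriv (fun t => L t a) t) := by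
      intro t
      refine tendsto_pi_nhds.2 fun a => ?_
      have h1 := (((hL a).differentiable (by simp)) t).hasDerivAt.tendsto_slope_zero
      have h2 : Tendsto (fun n : ℕ => 1 / ((n : ℝ) + 1)) atTop (𝓝[≠] 0) := by
        refine tendsto_nhdsWithin_iff.2 ⟨tendsto_one_div_add_atTop_nhds_zero_nat, ?_⟩
        filter_upwards with n
        exact (Nat.one_div_pos_of_nat).ne'
      simpa [Function.comp_def] using h1.comp h2
    let L' : ℝ → E →L[ℝ] ℝ := fun t => continuousLinearMapOfTendsto _ (hlim t)
    have hL' : ∀ a, (fun t => L' t a) = deriv (fun t => L t a) := fun a => rfl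
    obtain ⟨C, hC⟩ := ih (L := L') fun a => by
      rw [hL']; exact ((contDiff_infty_iff_deriv).1 (hL a)).2
    refine ⟨C, fun t ht a => ?_⟩
    rw [iteratedDeriv_succ', ← hL']
    exact hC t ht a

/-- Pairing of an absolutely summable family with a bounded one. -/
def lpPairing {α : Type*} (g : α → ℝ) (M : ℝ) (hM : ∀ s, |g s| ≤ M) :
    lp (fun _ : α => ℝ) 1 →L[ℝ] ℝ :=
  have hs : ∀ a : lp (fun _ : α => ℝ) 1, Summable fun s => ‖a s‖ := fun a => by
    simpa using (lp.memℓp a).summable (by simp)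
  have hs' : ∀ a : lp (fun _ : α => ℝ) 1, Summable fun s => a s * g s := fun a =>
    Summable.of_norm_bounded ((hs a).mul_right M) fun s => by
      rw [norm_mul]; exact mul_le_mul_of_nonneg_left (hM s) (norm_nonneg _)
  LinearMap.mkContinuous
    { toFun := fun a => ∑' s, a s * g s
      map_add' := fun a b => by
        simp only [lp.coeFn_add, Pi.add_apply, add_mul]
        exact (hs' a).tsum_add (hs' b)
      map_smul' := fun r a => by
        simp only [lp.coeFn_smul, Pi.smul_apply, smul_eq_mul, mul_assoc, RingHom.id_apply]
        exact tsum_mul_left } M fun a => by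
      have h1 : ‖a‖ = ∑' s, ‖a s‖ := by simpa using lp.norm_eq_tsum_rpow (p := 1) (by simp) a
      rw [h1, mul_comm, ← tsum_mul_right]
      refine tsum_of_norm_bounded ((hs a).mul_right M).hasSum fun s => ?_
      rw [norm_mul]; exact mul_le_mul_of_nonneg_left (hM s) (norm_nonneg _)

theorem lpPairing_apply {α : Type*} (g : α → ℝ) (M : ℝ) (hM : ∀ s, |g s| ≤ M)
    (a : lp (fun _ : α => ℝ) 1) : lpPairing g M hM a = ∑' s, a s * g s := rfl

/-- Point masses have norm 1 and recover the values of `g`; a bound on ℓ¹ thereby becomes a bound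
uniform in the points. -/
theorem lpPairing_single {α : Type*} [DecidableEq α] (g : α → ℝ) (M : ℝ) (hM : ∀ s, |g s| ≤ M)
    (s : α) : lpPairing g M hM (lp.single 1 s 1) = g s := by
  rw [lpPairing_apply, tsum_eq_single s (fun s' hs' => by
    rw [lp.single_apply_ne _ _ _ hs', zero_mul]), lp.single_apply_self, one_mul]

/-- A family of smooth functions that is weakly smooth is jointly smooth. -/
theorem contDiff_uncurry_of_tsum {g : ℝ → ℝ → ℝ} (hg : ∀ t, ContDiff ℝ ∞ (g t))
    (h : ∀ (R : ℝ) (m : ℕ) (a : Set.Icc (-R) R → ℝ), (Summable fun s => |a s|) →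
      ContDiff ℝ ∞ fun t => ∑' s, a s * iteratedDeriv m (g t) s) :
    ContDiff ℝ ∞ fun p : ℝ × ℝ => g p.1 p.2 := by
  classical
  have hle : ∀ m : ℕ, ((m : ℕ∞) : WithTop ℕ∞) ≤ ∞ := fun m => by exact_mod_cast le_top
  -- Local bounds for ∂_t^j ∂_s^m. Each slice gives a functional on ℓ¹ of the interval, with a norm
  -- bound M t that may depend on t; Banach–Steinhaus supplies the uniformity in t, and unit point
  -- masses the uniformity in s.
  have key : ∀ (R : ℝ) (m j : ℕ), ∃ C, ∀ t ∈ Set.Icc (-R) R, ∀ s ∈ Set.Icc (-R) R,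
      |iteratedDeriv j (fun t => iteratedDeriv m (g t) s) t| ≤ C := by
    intro R m j
    have h1 : ∀ t, ∃ M, ∀ s ∈ Set.Icc (-R) R, ‖iteratedDeriv m (g t) s‖ ≤ M := fun t =>
      isCompact_Icc.exists_bound_of_continuousOn
        ((hg t).continuous_iteratedDeriv m (hle m)).continuousOn
    choose M hM using h1
    obtain ⟨C, hC⟩ := exists_bound_iteratedDeriv_of_pointwise
      (L := fun t => lpPairing (fun s : Set.Icc (-R) R => iteratedDeriv m (g t) s) (M t)
        fun s => hM t s s.2)
      (fun a => by
        simp only [lpPairing_apply]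
        exact h R m a (by simpa using (lp.memℓp a).summable (by simp))) j R
    refine ⟨C * ‖(1 : ℝ)‖, fun t ht s hs => ?_⟩
    have h2 := hC t ht (lp.single 1 ⟨s, hs⟩ 1)
    simp only [lpPairing_single] at h2
    rwa [lp.norm_single (by simp)] at h2
  have hg' : ∀ s, ContDiff ℝ ∞ fun t => g t s := by
    intro s
    -- A point mass at s, in the smallest symmetric interval that contains s.
    have h1 := h |s| 0 (Pi.single ⟨s, neg_abs_le s, le_abs_self s⟩ 1) (by
      refine summable_of_ne_finset_zero (s := {⟨s, neg_abs_le s, le_abs_self s⟩}) fun b hb => ?_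
      rw [Pi.single_eq_of_ne (by simpa using hb), abs_zero])
    convert h1 using 2 with t
    rw [tsum_eq_single ⟨s, neg_abs_le s, le_abs_self s⟩ (fun b hb => by
      rw [Pi.single_eq_of_ne hb, zero_mul])]
    simp
  let f : EuclideanSpace ℝ (Fin 2) → ℝ := fun x => g (x 0) (x 1)
  have hnear : ∀ x₀ : EuclideanSpace ℝ (Fin 2), ∃ R : ℝ, ∀ᶠ x in 𝓝 x₀,
      x 0 ∈ Set.Icc (-R) R ∧ x 1 ∈ Set.Icc (-R) R := by
    intro x₀
    have hc : ∀ i, Continuous fun x : EuclideanSpace ℝ (Fin 2) => |x i| := fun i => by fun_prop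
    refine ⟨max |x₀ 0| |x₀ 1| + 1, ?_⟩
    filter_upwards [((hc 0).tendsto x₀).eventually (gt_mem_nhds
      ((le_max_left |x₀ 0| |x₀ 1|).trans_lt (lt_add_one _))),
      ((hc 1).tendsto x₀).eventually (gt_mem_nhds
      ((le_max_right |x₀ 0| |x₀ 1|).trans_lt (lt_add_one _)))] with x h0 h1
    exact ⟨abs_le.1 h0.le, abs_le.1 h1.le⟩
  have hf0 : ∀ x : EuclideanSpace ℝ (Fin 2), ∀ r : ℝ,
      f (x + r • EuclideanSpace.single 0 1) = g (x 0 + r) (x 1) := by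
    intro x r; simp [f]
  have hf1 : ∀ x : EuclideanSpace ℝ (Fin 2), ∀ r : ℝ,
      f (x + r • EuclideanSpace.single 1 1) = g (x 0) (x 1 + r) := by
    intro x r; simp [f]
  have hcont : Continuous f := by
    rw [continuous_iff_continuousAt]
    intro x₀
    obtain ⟨R, hR⟩ := hnear x₀
    -- The bound on ∂_s makes g(t, ·) Lipschitz uniformly in t, so joint continuity reduces to
    -- continuity in t at the fixed second coordinate x₀ 1.
    obtain ⟨C, hC⟩ := key R 1 0
    rw [ContinuousAt, tendsto_iff_dist_tendsto_zero]
    have h5 : Tendsto (fun x : EuclideanSpace ℝ (Fin 2) =>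
        C * |x 1 - x₀ 1| + |g (x 0) (x₀ 1) - g (x₀ 0) (x₀ 1)|) (𝓝 x₀)
        (𝓝 0) := by
      have h6 := (hg' (x₀ 1)).continuous
      have : Continuous fun x : EuclideanSpace ℝ (Fin 2) =>
          C * |x 1 - x₀ 1| + |g (x 0) (x₀ 1) - g (x₀ 0) (x₀ 1)| := by
        have h7 : Continuous fun x : EuclideanSpace ℝ (Fin 2) => g (x 0) (x₀ 1) :=
          h6.comp (by fun_prop)
        fun_prop
      simpa using this.tendsto x₀
    refine squeeze_zero' (Eventually.of_forall fun _ => dist_nonneg) ?_ h5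
    filter_upwards [hR] with x hx
    have h7 := (convex_Icc (-R) R).norm_image_sub_le_of_norm_deriv_le (f := g (x 0)) (C := C)
      (fun s _ => ((hg (x 0)).differentiable (by simp)).differentiableAt)
      (fun s hs => by simpa [iteratedDeriv_one] using hC _ hx.1 s hs) hR.self_of_nhds.2 hx.2
    rw [Real.dist_eq]
    refine (abs_sub_le _ (g (x 0) (x₀ 1)) _).trans (add_le_add h7 le_rfl)
  have hsm : ContDiff ℝ ∞ f := by
    refine contDiff_of_isLineSmooth (EuclideanSpace.basisFun (Fin 2) ℝ) hcont fun i => ?_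
    rw [EuclideanSpace.basisFun_apply]
    fin_cases i
    · refine ⟨fun x => ?_, fun j x₀ => ?_⟩
      · simp only [Fin.zero_eta, Fin.isValue, hf0]
        exact (hg' _).comp (by fun_prop)
      · obtain ⟨R, hR⟩ := hnear x₀
        obtain ⟨C, hC⟩ := key R 0 j
        refine ⟨C, hR.mono fun x hx => ?_⟩
        have h1 := hC _ hx.1 _ hx.2
        simp only [Fin.zero_eta, Fin.isValue, iteratedLineDeriv, hf0]
        have h2 := congrFun (iteratedDeriv_comp_const_add j (fun t => g t (x 1)) (x 0)) 0
        rw [h2]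
        simpa using h1
    · refine ⟨fun x => ?_, fun j x₀ => ?_⟩
      · simp only [Fin.mk_one, Fin.isValue, hf1]
        exact (hg _).comp (by fun_prop)
      · obtain ⟨R, hR⟩ := hnear x₀
        obtain ⟨C, hC⟩ := key R j 0
        refine ⟨C, hR.mono fun x hx => ?_⟩
        have h1 := hC _ hx.1 _ hx.2
        simp only [Fin.mk_one, Fin.isValue, iteratedLineDeriv, hf1]
        have h2 := congrFun (iteratedDeriv_comp_const_add j (g (x 0)) (x 1)) 0
        rw [h2]
        simpa using h1
  have h8 : ContDiff ℝ ∞ fun p : ℝ × ℝ =>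
      (WithLp.toLp 2 ![p.1, p.2] : EuclideanSpace ℝ (Fin 2)) := by
    refine contDiff_euclidean.2 fun i => ?_
    fin_cases i
    · exact contDiff_fst
    · exact contDiff_snd
  exact hsm.comp h8

theorem ContDiff.iteratedLineDeriv {V : Type*} [NormedAddCommGroup V] [NormedSpace ℝ V] {f : V → ℝ}
    (hf : ContDiff ℝ ∞ f) (v : V) (j : ℕ) : ContDiff ℝ ∞ (iteratedLineDeriv f v j) := by
  induction j generalizing f with
  | zero => simpa only [funext (iteratedLineDeriv_zero f v)] using hf
  | succ j ih =>
    simp only [funext (iteratedLineDeriv_succ' (hf.differentiable (by simp)) v j)]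
    exact ih ((hf.fderiv_right (m := ∞) (by simp)).clm_apply contDiff_const)

/-- Near a given t₀, `H` may be multiplied by cutoffs in both variables that equal 1 near t₀ and on
[-R, R]. The t-derivatives are then globally bounded, and the summability of `a` allows termwise
differentiation. -/
theorem contDiff_tsum_mul {H : ℝ × ℝ → ℝ} (hH : ContDiff ℝ ∞ H) (R : ℝ) {a : Set.Icc (-R) R → ℝ}
    (ha : Summable fun s => |a s|) : ContDiff ℝ ∞ fun t => ∑' s, a s * H (t, s) := by
  rw [contDiff_iff_contDiffAt]
  intro t₀
  let ρ : ContDiffBump t₀ := ⟨1, 2, one_pos, one_lt_two⟩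
  let σ : ContDiffBump (0 : ℝ) := ⟨|R| + 1, |R| + 2, by positivity, by linarith⟩
  set G : ℝ × ℝ → ℝ := fun p => ρ p.1 * σ p.2 * H p with hG
  have hGs : ContDiff ℝ ∞ G :=
    ((ρ.contDiff.comp contDiff_fst).mul (σ.contDiff.comp contDiff_snd)).mul hH
  have hGc : HasCompactSupport G := by
    refine HasCompactSupport.intro
      (ρ.hasCompactSupport.isCompact.prod σ.hasCompactSupport.isCompact)
      fun p hp => ?_
    rw [Set.mem_prod, not_and_or] at hp
    rcases hp with hp | hp
    · simp [hG, image_eq_zero_of_notMem_tsupport hp]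
    · simp [hG, image_eq_zero_of_notMem_tsupport hp]
  have hb : ∀ n, ∃ C, ∀ p, ‖iteratedLineDeriv G (1, 0) n p‖ ≤ C := fun n =>
    HasCompactSupport.exists_bound_of_continuous
      (HasCompactSupport.intro hGc.isCompact fun p hp => iteratedLineDeriv_eq_zero hp _ _)
      (hGs.continuous_iteratedLineDeriv _ _)
  choose C hC using hb
  have hGt : ∀ s : ℝ, ContDiff ℝ ∞ fun t => G (t, s) := fun s => hGs.comp (by fun_prop)
  have hsm : ContDiff ℝ ∞ fun t => ∑' s, a s * G (t, s) := by
    refine contDiff_tsum (N := ⊤) (v := fun n s => |a s| * C n)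
      (fun s => contDiff_const.mul (hGt s)) (fun n _ => ha.mul_right _) fun n s t _ => ?_
    have hle : ((n : ℕ∞) : WithTop ℕ∞) ≤ ∞ := by exact_mod_cast le_top
    rw [norm_iteratedFDeriv_eq_norm_iteratedDeriv,
      iteratedDeriv_const_mul _ ((hGt s).of_le hle).contDiffAt, norm_mul, Real.norm_eq_abs]
    refine mul_le_mul_of_nonneg_left ?_ (abs_nonneg _)
    have h1 := hC n ((0, (s : ℝ)) + t • (1, 0))
    rw [iteratedLineDeriv_add_smul] at h1
    simpa using h1
  refine hsm.contDiffAt.congr_of_eventuallyEq ?_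
  filter_upwards [ρ.eventuallyEq_one] with t ht
  refine tsum_congr fun s => ?_
  have h2 : σ (s : ℝ) = 1 := σ.one_of_mem_closedBall (mem_closedBall_zero_iff.2 (by
    have h3 : |(s : ℝ)| ≤ R := abs_le.2 s.2
    change |(s : ℝ)| ≤ |R| + 1
    linarith [le_abs_self R]))
  simp only [hG, h2, ht, Pi.one_apply, one_mul]

end ExponentialLawReal

/-! ### Curves of function spaces and cartesian closedness -/

namespace Frolicher

variable {X : Type u} {Y : Type v} {Z : Type w} [Frolicher X] [Frolicher Y] [Frolicher Z]

theorem mem_curves_pi_real {n : ℕ} {c : ℝ → Fin n → ℝ} :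
    c ∈ curves (X := Fin n → ℝ) ↔ ContDiff ℝ ∞ c :=
  (contDiff_pi (n := ∞) (Φ := c)).symm

theorem contDiff_of_mem_functions {n : ℕ} {f : (Fin n → ℝ) → ℝ}
    (hf : f ∈ functions (X := Fin n → ℝ)) : ContDiff ℝ ∞ f :=
  contDiff_of_contDiff_comp_curve fun c hc =>
    (mem_functions_iff f).1 hf c (mem_curves_pi_real.2 hc)

theorem IsSmooth.contDiff_prod_real {f : ℝ × ℝ → ℝ} (hf : IsSmooth f) : ContDiff ℝ ∞ f :=
  contDiff_of_contDiff_comp_curve fun c hc =>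
    hf c ⟨contDiff_fst.comp hc, contDiff_snd.comp hc⟩

theorem isSmooth_real_of_mem_functions {f : X → ℝ} (hf : f ∈ functions (X := X)) : IsSmooth f :=
  fun c hc => (mem_functions_iff f).1 hf c hc

theorem isSmooth_fst : IsSmooth (Prod.fst : X × Y → X) := fun _ hc => hc.1

theorem isSmooth_snd : IsSmooth (Prod.snd : X × Y → Y) := fun _ hc => hc.2

theorem IsSmooth.prodMk {f : Z → X} {g : Z → Y} (hf : IsSmooth f) (hg : IsSmooth g) :
    IsSmooth fun z => (f z, g z) :=
  fun c hc => ⟨hf c hc, hg c hc⟩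

theorem const_mem_curves (x : X) : (fun _ : ℝ => x) ∈ curves (X := X) :=
  isSmooth_const (X := ℝ) x id (contDiff_id (n := ∞))

theorem isSmooth_of_mem_curves {c : ℝ → X} (hc : c ∈ curves (X := X)) : IsSmooth c :=
  fun _ hr => (mem_curves_iff _).2 fun χ hχ => ((mem_curves_iff c).1 hc χ hχ).comp hr

end Frolicher

namespace SmoothMap

variable {X : Type u} {Y : Type v} {Z : Type w} [Frolicher X] [Frolicher Y] [Frolicher Z]

theorem contDiff_uncurry_of_mem_curves {c : ℝ → SmoothMap ℝ ℝ}
    (hc : c ∈ curves (X := SmoothMap ℝ ℝ)) : ContDiff ℝ ∞ fun p : ℝ × ℝ => c p.1 p.2 := by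
  refine contDiff_uncurry_of_tsum (g := fun t => c t)
    (fun t => (c t).smooth _root_.id (contDiff_id (n := ∞))) fun R m a ha => ?_
  -- This functional is a structure function of C^∞(ℝ, ℝ): along generating curves, which are
  -- jointly smooth by Boman's theorem, its smoothness is `contDiff_tsum_mul`. Every curve of the
  -- generated structure must therefore pass the test.
  refine (mem_curves_iff c).1 hc (fun g => ∑' s : Set.Icc (-R) R, a s * iteratedDeriv m g s) ?_
  intro γ hγ
  have hγ' : ContDiff ℝ ∞ fun p : ℝ × ℝ => γ p.1 p.2 := IsSmooth.contDiff_prod_real hγ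
  have h := contDiff_tsum_mul (hγ'.iteratedLineDeriv (0, 1) m) R ha
  convert h using 2 with t
  refine tsum_congr fun s => ?_
  have h1 := iteratedLineDeriv_add_smul (fun p : ℝ × ℝ => γ p.1 p.2) (0, 1) m (t, 0) s
  simp only [Prod.smul_mk, smul_eq_mul, mul_zero, mul_one, Prod.mk_add_mk, add_zero,
    zero_add] at h1
  rw [h1]

/-- The curves of a function space are exactly the generating ones. -/
theorem isSmooth_uncurry_of_mem_curves {c : ℝ → SmoothMap X Y}
    (hc : c ∈ curves (X := SmoothMap X Y)) : IsSmooth fun p : ℝ × X => c p.1 p.2 := by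
  intro d hd
  refine (mem_curves_iff _).2 fun χ hχ => ?_
  -- Composition with `χ'` on the left and with the curve `d'` on the right carries `c` to a curve
  -- in C^∞(ℝ, ℝ), for which joint smoothness is known. The required function is the resulting
  -- function of two variables along t ↦ ((d t).1, t).
  let χ' : SmoothMap Y ℝ := ⟨χ, isSmooth_real_of_mem_functions hχ⟩
  let d' : SmoothMap ℝ X := ⟨fun t => (d t).2, isSmooth_of_mem_curves hd.2⟩
  have h1 := isSmooth_comp_right d' _ (isSmooth_comp_left χ' c hc)
  have h2 := contDiff_uncurry_of_mem_curves h1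
  have h3 : ContDiff ℝ ∞ fun t => (d t).1 := hd.1
  exact h2.comp (h3.prodMk contDiff_id)

theorem isSmooth_eval : IsSmooth fun p : Y × SmoothMap Y X => p.2 p.1 := by
  intro d hd
  exact isSmooth_uncurry_of_mem_curves hd.2 (fun t => (t, (d t).1))
    ⟨(contDiff_id (n := ∞)), hd.1⟩

theorem isSmooth_curry {f : Y × Z → X} (hf : IsSmooth f) :
    IsSmooth fun z => (⟨fun y => f (y, z), hf.comp (isSmooth_id.prodMk (isSmooth_const z))⟩ :
      SmoothMap Y X) := by
  intro c hc
  refine mem_ofCurves ?_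
  change IsSmooth fun p : ℝ × Y => f (p.2, c p.1)
  exact hf.comp (isSmooth_snd.prodMk ((isSmooth_of_mem_curves hc).comp isSmooth_fst))

theorem isSmooth_uncurry {g : Z → SmoothMap Y X} (hg : IsSmooth g) :
    IsSmooth fun p : Y × Z => g p.2 p.1 :=
  isSmooth_eval.comp (isSmooth_fst.prodMk (hg.comp isSmooth_snd))

end SmoothMap

/-- A map out of a product of generated structures is smooth as soon as it is smooth along pairs of
generating curves, provided that the generating curves cover. -/
theorem Frolicher.isSmooth_prod_ofCurves {A : Type u} {B : Type v} {Z : Type w}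
    [Frolicher Z] {C : Set (ℝ → A)} {D : Set (ℝ → B)} (hC : ∀ a, ∃ γ ∈ C, ∃ t, γ t = a)
    (hD : ∀ b, ∃ δ ∈ D, ∃ t, δ t = b) {φ : A × B → Z}
    (h : ∀ γ ∈ C, ∀ δ ∈ D, IsSmooth fun p : ℝ × ℝ => φ (γ p.1, δ p.2)) :
    @IsSmooth (A × B) Z (@instProd A B (ofCurves C) (ofCurves D)) _ φ := by
  let _ : Frolicher A := ofCurves C
  let _ : Frolicher B := ofCurves D
  have h1 : ∀ δ ∈ D, IsSmooth fun p : ℝ × A => φ (p.2, δ p.1) := by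
    intro δ hδ
    have h2 : ∀ a, IsSmooth fun s : ℝ => φ (a, δ s) := by
      intro a
      obtain ⟨γ, hγ, t, rfl⟩ := hC a
      exact (h γ hγ δ hδ).comp ((isSmooth_const t).prodMk isSmooth_id)
    -- With a generating curve δ fixed, the map becomes one from A to a function space, where
    -- testing on generators of A is enough; uncurrying returns joint smoothness. The same argument
    -- in the other variable then removes δ.
    have h3 : IsSmooth fun a : A => (⟨fun s => φ (a, δ s), h2 a⟩ : SmoothMap ℝ Z) :=
      isSmooth_ofCurves C fun γ hγ => mem_ofCurves (h γ hγ δ hδ)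
    exact SmoothMap.isSmooth_uncurry h3
  have h4 : ∀ b, IsSmooth fun a : A => φ (a, b) := by
    intro b
    obtain ⟨δ, hδ, t, rfl⟩ := hD b
    exact (h1 δ hδ).comp ((isSmooth_const t).prodMk isSmooth_id)
  have h5 : IsSmooth fun b : B => (⟨fun a => φ (a, b), h4 b⟩ : SmoothMap A Z) :=
    isSmooth_ofCurves D fun δ hδ => mem_ofCurves (h1 δ hδ)
  exact SmoothMap.isSmooth_uncurry h5

namespace FS

/-- The exponential adjunction `Y × (·) ⊣ (·)^Y`. -/
def expAdjunction (Y : FS.{u}) : tensorLeft Y ⊣ expFunctor.obj (Opposite.op Y) :=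
  Adjunction.mkOfUnitCounit
    { unit :=
        { app := fun Z => (⟨fun z => ⟨fun y => (y, z), isSmooth_id.prodMk (isSmooth_const z)⟩,
            SmoothMap.isSmooth_curry (X := Y × Z) isSmooth_id⟩ :
              SmoothMap Z (SmoothMap Y (Y × Z)))
          naturality := fun _ _ _ => rfl }
      counit :=
        { app := fun X => (⟨fun p => p.2 p.1, SmoothMap.isSmooth_eval⟩ :
            SmoothMap (Y × SmoothMap Y X) X)
          naturality := fun _ _ _ => rfl }
      left_triangle := rfl
      right_triangle := rfl }

theorem expAdjunction_counit_app (Y X : FS.{u}) (y : Y) (f : SmoothMap Y X) :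
    (expAdjunction Y).counit.app X (y, f) = f y := rfl

end FS

/-! ### Taylor evaluation as the exponential of a nilpotent differential operator -/

section NilpotentExponential

variable {A : Type*} [Ring A] [Algebra ℝ A]

/-- The exponential series of a nilpotent element of a real algebra. -/
def nilExp (a : A) : A :=
  @IsNilpotent.exp A _ (Module.compHom A (algebraMap ℚ ℝ)) a

theorem nilExp_eq_sum {a : A} {k : ℕ} (h : a ^ k = 0) :
    nilExp a = ∑ i ∈ Finset.range k, (i.factorial : ℝ)⁻¹ • a ^ i := by
  let _ : Module ℚ A := Module.compHom A (algebraMap ℚ ℝ)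
  refine (IsNilpotent.exp_eq_sum h).trans (Finset.sum_congr rfl fun i _ => ?_)
  change (algebraMap ℚ ℝ (i.factorial : ℚ)⁻¹) • a ^ i = _
  simp

theorem nilExp_add_of_commute {a b : A} (h : Commute a b) (ha : IsNilpotent a)
    (hb : IsNilpotent b) : nilExp (a + b) = nilExp a * nilExp b :=
  let _ : Module ℚ A := Module.compHom A (algebraMap ℚ ℝ)
  IsNilpotent.exp_add_of_commute h ha hb

end NilpotentExponential

section TaylorOperators

/-- The space of smooth functions on a normed space. -/
def SmoothFn (E : Type*) [NormedAddCommGroup E] [NormedSpace ℝ E] : Submodule ℝ (E → ℝ) where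
  carrier := {f | ContDiff ℝ ∞ f}
  add_mem' hf hg := ContDiff.add (n := ∞) hf hg
  zero_mem' := contDiff_const (n := ∞) (c := (0 : ℝ))
  smul_mem' _ _ hf := ContDiff.smul (n := ∞) contDiff_const hf

variable {E : Type*} [NormedAddCommGroup E] [NormedSpace ℝ E]
  {E' : Type*} [NormedAddCommGroup E'] [NormedSpace ℝ E']
  {W : Type} [CommRing W] [Algebra ℝ W]

theorem contDiff_coe_smoothFn (f : SmoothFn E) : ContDiff ℝ ∞ f.1 := f.2

theorem differentiable_coe_smoothFn (f : SmoothFn E) : Differentiable ℝ f.1 :=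
  (contDiff_coe_smoothFn f).differentiable (by simp)

/-- The derivative in the direction `v` as an operator on smooth functions. -/
def dirDeriv (v : E) : SmoothFn E →ₗ[ℝ] SmoothFn E where
  toFun f := ⟨fun x => fderiv ℝ f.1 x v,
    ((contDiff_coe_smoothFn f).fderiv_right (m := ∞) (by simp)).clm_apply contDiff_const⟩
  map_add' f g := Subtype.ext <| funext fun x => by
    simp [fderiv_add (differentiable_coe_smoothFn f x) (differentiable_coe_smoothFn g x)]
  map_smul' c f := Subtype.ext <| funext fun x => by
    simp [fderiv_const_smul (differentiable_coe_smoothFn f x)]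

theorem dirDeriv_apply (v : E) (f : SmoothFn E) (x : E) :
    (dirDeriv v f).1 x = fderiv ℝ f.1 x v := rfl

theorem dirDeriv_add (v w : E) : dirDeriv (v + w) = dirDeriv v + dirDeriv w :=
  LinearMap.ext fun f => Subtype.ext <| funext fun x => by simp [dirDeriv]

theorem dirDeriv_comm (v w : E) (f : SmoothFn E) :
    dirDeriv v (dirDeriv w f) = dirDeriv w (dirDeriv v f) := by
  have key : ∀ (v w : E) (x : E), (dirDeriv v (dirDeriv w f)).1 x =
      fderiv ℝ (fderiv ℝ f.1) x v w := by
    intro v w x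
    have h : DifferentiableAt ℝ (fderiv ℝ f.1) x :=
      ((contDiff_coe_smoothFn f).fderiv_right (m := ∞) (by simp)).differentiable (by simp) x
    change fderiv ℝ (fun y => fderiv ℝ f.1 y w) x v = _
    rw [fderiv_clm_apply h (differentiableAt_const _)]
    simp
  refine Subtype.ext <| funext fun x => ?_
  rw [key, key]
  exact ((contDiff_coe_smoothFn f).contDiffAt.isSymmSndFDerivAt
    (by simpa using (by exact_mod_cast le_top : ((2 : ℕ∞) : WithTop ℕ∞) ≤ ∞))) v w

/-- Composition with the derivative in the direction `v`, on functionals. -/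
def dualDeriv (W : Type) [CommRing W] [Algebra ℝ W] (v : E) :
    Module.End W (SmoothFn E →ₗ[ℝ] W) :=
  LinearMap.lcomp W W (dirDeriv v)

theorem dualDeriv_apply (v : E) (ℓ : SmoothFn E →ₗ[ℝ] W) (f : SmoothFn E) :
    dualDeriv W v ℓ f = ℓ (dirDeriv v f) := rfl

theorem dualDeriv_commute (v w : E) : Commute (dualDeriv W v) (dualDeriv W w) :=
  LinearMap.ext fun ℓ => LinearMap.ext fun f => congrArg ℓ (dirDeriv_comm w v f)

/-- The operator `∑ aᵢ ∂_{vᵢ}` on `W`-valued functionals on smooth functions. -/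
def taylorOp {ι : Type*} [Fintype ι] (v : ι → E) (a : ι → W) :
    Module.End W (SmoothFn E →ₗ[ℝ] W) :=
  ∑ i, a i • dualDeriv W (v i)

theorem taylorOp_apply {ι : Type*} [Fintype ι] (v : ι → E) (a : ι → W)
    (ℓ : SmoothFn E →ₗ[ℝ] W) (f : SmoothFn E) :
    taylorOp v a ℓ f = ∑ i, a i * ℓ (dirDeriv (v i) f) := by
  simp [taylorOp, LinearMap.sum_apply, dualDeriv_apply]

theorem taylorOp_commute {ι κ : Type*} [Fintype ι] [Fintype κ] (v : ι → E) (a : ι → W)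
    (w : κ → E) (b : κ → W) : Commute (taylorOp v a) (taylorOp w b) :=
  Commute.sum_left _ _ _ fun _ _ => Commute.sum_right _ _ _ fun _ _ =>
    ((dualDeriv_commute _ _).smul_left _).smul_right _

theorem isNilpotent_taylorOp {ι : Type*} [Fintype ι] (v : ι → E) {a : ι → W}
    (ha : ∀ i, IsNilpotent (a i)) : IsNilpotent (taylorOp v a) := by
  refine Commute.isNilpotent_sum (fun i _ => ?_) fun i j _ _ =>
    ((dualDeriv_commute _ _).smul_left _).smul_right _
  obtain ⟨k, hk⟩ := ha i
  exact ⟨k, by rw [smul_pow, hk, zero_smul]⟩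

theorem taylorOp_add {ι : Type*} [Fintype ι] (v w : ι → E) (a : ι → W) :
    taylorOp (fun i => v i + w i) a = taylorOp v a + taylorOp w a := by
  refine LinearMap.ext fun ℓ => LinearMap.ext fun f => ?_
  simp [taylorOp_apply, dirDeriv_add, mul_add, Finset.sum_add_distrib]

/-- Evaluation at `x` as a `W`-valued functional. -/
def evalFunctional (W : Type) [CommRing W] [Algebra ℝ W] (x : E) : SmoothFn E →ₗ[ℝ] W :=
  Algebra.linearMap ℝ W ∘ₗ LinearMap.proj x ∘ₗ (SmoothFn E).subtype

theorem evalFunctional_apply (x : E) (f : SmoothFn E) :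
    evalFunctional W x f = algebraMap ℝ W (f.1 x) := rfl

/-- Restriction of a smooth function to the affine map `s ↦ x + ∑ sᵢ vᵢ`. -/
def affinePullback {n : ℕ} (x : E) (v : Fin n → E) (f : SmoothFn E) : SmoothFn (Fin n → ℝ) :=
  ⟨fun s => f.1 (x + ∑ i, s i • v i), (contDiff_coe_smoothFn f).comp (by fun_prop)⟩

theorem dirDeriv_affine {n : ℕ} (x : E) (v : Fin n → E) (f : SmoothFn E) (i : Fin n) :
    dirDeriv (Pi.single i (1 : ℝ)) (affinePullback x v f) =
      affinePullback x v (dirDeriv (v i) f) := by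
  refine Subtype.ext <| funext fun s => ?_
  have h1 : HasFDerivAt (fun s : Fin n → ℝ => x + ∑ i, s i • v i)
      (∑ i, (ContinuousLinearMap.proj (R := ℝ) (φ := fun _ : Fin n => ℝ) i).smulRight (v i)) s := by
    refine HasFDerivAt.const_add _ (HasFDerivAt.fun_sum fun i _ => ?_)
    exact (hasFDerivAt_apply i s).smul_const (v i)
  have h2 := (differentiable_coe_smoothFn f (x + ∑ i, s i • v i)).hasFDerivAt.comp s h1
  change fderiv ℝ (f.1 ∘ fun s : Fin n → ℝ => x + ∑ i, s i • v i) s (Pi.single i 1) = _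
  rw [h2.fderiv]
  simp [Pi.single_apply, ite_smul, affinePullback, dirDeriv_apply]

theorem taylorOp_pow_affine {n : ℕ} (x : E) (v : Fin n → E) (a : Fin n → W) (k : ℕ)
    (f : SmoothFn E) :
    (taylorOp (fun i => Pi.single i (1 : ℝ)) a ^ k) (evalFunctional W 0) (affinePullback x v f) =
      (taylorOp v a ^ k) (evalFunctional W x) f := by
  induction k generalizing f with
  | zero => simp [evalFunctional_apply, affinePullback]
  | succ k ih =>
    rw [pow_succ', pow_succ', Module.End.mul_apply, Module.End.mul_apply, taylorOp_apply,
      taylorOp_apply]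
    exact Finset.sum_congr rfl fun i _ => by rw [dirDeriv_affine, ih]

/-- Expanding the k-th power over multi-indices gives k! times the degree k Taylor term, which links
the definition of `taylorTerm` to the exponential series. -/
theorem taylorOp_pow_eq_sum {n : ℕ} (a : Fin n → W) (k : ℕ) (f : SmoothFn (Fin n → ℝ)) :
    (taylorOp (fun i => Pi.single i (1 : ℝ)) a ^ k) (evalFunctional W 0) f =
      ∑ i : Fin k → Fin n, iteratedFDeriv ℝ k f.1 0 (fun j => Pi.single (i j) (1 : ℝ)) •
        ∏ j, a (i j) := by
  induction k generalizing f with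
  | zero => simp [evalFunctional_apply, Algebra.algebraMap_eq_smul_one]
  | succ k ih =>
    rw [pow_succ', Module.End.mul_apply, taylorOp_apply,
      -- The outermost operator differentiates `f` first, and this is the last slot of the iterated
      -- derivative; hence the multi-index is split at its last entry.
      ← (Fin.snocEquiv fun _ => Fin n).sum_comp, Fintype.sum_prod_type]
    refine Finset.sum_congr rfl fun l _ => ?_
    rw [ih, Finset.mul_sum]
    refine Finset.sum_congr rfl fun i _ => ?_
    rw [iteratedFDeriv_succ_apply_right, Fin.prod_univ_castSucc]
    have h1 : ContDiff ℝ ∞ (fderiv ℝ f.1) :=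
      (contDiff_coe_smoothFn f).fderiv_right (m := ∞) (by simp)
    have h2 : iteratedFDeriv ℝ k (dirDeriv (Pi.single l (1 : ℝ)) f).1 0
        (fun j => Pi.single (i j) (1 : ℝ)) = iteratedFDeriv ℝ k (fderiv ℝ f.1) 0
        (fun j => Pi.single (i j) (1 : ℝ)) (Pi.single l (1 : ℝ)) := by
      have h3 := (ContinuousLinearMap.apply ℝ ℝ
        (Pi.single l (1 : ℝ) : Fin n → ℝ)).iteratedFDeriv_comp_left (f := fderiv ℝ f.1) (x := 0)
        h1.contDiffAt (i := k) (by exact_mod_cast le_top)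
      exact congrArg (fun m => m fun j => Pi.single (i j) (1 : ℝ)) h3
    rw [h2]
    have h4 : (Fin.init (α := fun _ => Fin n → ℝ)
        fun j => Pi.single ((Fin.snocEquiv fun _ => Fin n) (l, i) j) (1 : ℝ)) =
        fun j => (Pi.single (i j) (1 : ℝ) : Fin n → ℝ) := by
      ext1 j; simp [Fin.init, Fin.snocEquiv]
    rw [h4]
    simp [Fin.snocEquiv, mul_comm]

/-- The value of a smooth function at a nilpotent tuple, along an affine map, as an exponential. -/
theorem taylorEval_affine {n : ℕ} (x : E) (v : Fin n → E) {a : Fin n → W}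
    (ha : ∀ i, IsNilpotent (a i)) (f : SmoothFn E) :
    taylorEval (fun s => f.1 (x + ∑ i, s i • v i)) a =
      nilExp (taylorOp v a) (evalFunctional W x) f := by
  obtain ⟨N, hN⟩ := isNilpotent_taylorOp v ha
  have hterm : ∀ k, taylorTerm (fun s => f.1 (x + ∑ i, s i • v i)) a k =
      (k.factorial : ℝ)⁻¹ • (taylorOp v a ^ k) (evalFunctional W x) f := fun k => by
    rw [← taylorOp_pow_affine, taylorOp_pow_eq_sum]; rfl
  rw [nilExp_eq_sum hN, taylorEval, finsum_eq_sum_of_support_subset (s := Finset.range N)]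
  · simp [hterm, LinearMap.sum_apply]
  · intro k hk
    by_contra h
    rw [Finset.coe_range, Set.mem_Iio, not_lt] at h
    exact hk (by rw [hterm, pow_eq_zero_of_le h hN]; simp)

/-- A family of functionals that differentiates under a derivative of the base point. -/
def IsTranslationFamily (ℓ : E → SmoothFn E →ₗ[ℝ] W) : Prop :=
  ∀ (ψ : W →ₗ[ℝ] ℝ) (f : SmoothFn E) (x w : E),
    HasLineDerivAt ℝ (fun x => ψ (ℓ x f)) (ψ (ℓ x (dirDeriv w f))) x w

theorem isTranslationFamily_evalFunctional : IsTranslationFamily (evalFunctional W (E := E)) := by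
  intro ψ f x w
  have h : HasDerivAt (fun r : ℝ => f.1 (x + r • w)) (fderiv ℝ f.1 x w) 0 :=
    (differentiable_coe_smoothFn f x).hasFDerivAt.hasLineDerivAt w
  have h2 := h.mul_const (ψ 1)
  simpa [HasLineDerivAt, evalFunctional_apply, Algebra.algebraMap_eq_smul_one, dirDeriv_apply]
    using h2

theorem IsTranslationFamily.sum {κ : Type*} (s : Finset κ) {ℓ : κ → E → SmoothFn E →ₗ[ℝ] W}
    (h : ∀ k, IsTranslationFamily (ℓ k)) : IsTranslationFamily fun x => ∑ k ∈ s, ℓ k x := by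
  intro ψ f x w
  simp only [LinearMap.sum_apply, map_sum]
  exact HasDerivAt.fun_sum fun k _ => h k ψ f x w

theorem IsTranslationFamily.smul {ℓ : E → SmoothFn E →ₗ[ℝ] W} (h : IsTranslationFamily ℓ) (c : ℝ) :
    IsTranslationFamily fun x => c • ℓ x := by
  intro ψ f x w
  simp only [LinearMap.smul_apply, map_smul, smul_eq_mul]
  exact HasDerivAt.const_mul c (h ψ f x w)

/-- The operator has constant coefficients, so it commutes with directional derivatives. -/
theorem IsTranslationFamily.taylorOp {ι : Type*} [Fintype ι] (v : ι → E) (a : ι → W)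
    {ℓ : E → SmoothFn E →ₗ[ℝ] W} (h : IsTranslationFamily ℓ) :
    IsTranslationFamily fun x => taylorOp v a (ℓ x) := by
  intro ψ f x w
  simp only [taylorOp_apply, map_sum]
  refine HasDerivAt.fun_sum fun i _ => ?_
  have := h (ψ ∘ₗ LinearMap.mulLeft ℝ (a i)) (dirDeriv (v i) f) x w
  rw [dirDeriv_comm] at this
  exact this

theorem IsTranslationFamily.nilExp {ι : Type*} [Fintype ι] (v : ι → E) {a : ι → W}
    (ha : ∀ i, IsNilpotent (a i)) {ℓ : E → SmoothFn E →ₗ[ℝ] W} (h : IsTranslationFamily ℓ) :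
    IsTranslationFamily fun x => nilExp (_root_.taylorOp v a) (ℓ x) := by
  obtain ⟨N, hN⟩ := isNilpotent_taylorOp v ha
  have hpow : ∀ k : ℕ, IsTranslationFamily fun x => (_root_.taylorOp v a ^ k) (ℓ x) := by
    intro k
    induction k with
    | zero => exact h
    | succ k ih => simp only [pow_succ']; exact ih.taylorOp v a
  have hsum : _root_.nilExp (_root_.taylorOp v a) = ∑ i ∈ Finset.range N,
      (i.factorial : ℝ)⁻¹ • _root_.taylorOp v a ^ i := nilExp_eq_sum hN
  simp only [hsum, LinearMap.sum_apply, LinearMap.smul_apply]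
  exact IsTranslationFamily.sum _ fun k => (hpow k).smul _

theorem sum_add_single_smul {κ : Type*} [Fintype κ] [DecidableEq κ] (u : κ → E) (t : κ → ℝ) (j : κ)
    (r : ℝ) : (∑ i, (t + r • (Pi.single j (1 : ℝ) : κ → ℝ)) i • u i) =
      (∑ i, t i • u i) + r • u j := by
  simp [add_smul, Finset.sum_add_distrib, Pi.single_apply, ite_smul]

/-- Differentiate the identity in the parameter t_j. Linear functionals ψ on W reduce this to
uniqueness of real derivatives, so that no topology on W is needed. -/
theorem IsTranslationFamily.dirDeriv_eq {κ : Type*} [Fintype κ]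
    {ℓ : E → SmoothFn E →ₗ[ℝ] W} {ℓ' : E' → SmoothFn E' →ₗ[ℝ] W} (hℓ : IsTranslationFamily ℓ)
    (hℓ' : IsTranslationFamily ℓ') {w : κ → E} {w' : κ → E'} {f : SmoothFn E} {f' : SmoothFn E'}
    (h : ∀ t : κ → ℝ, ℓ (∑ j, t j • w j) f = ℓ' (∑ j, t j • w' j) f') (j : κ) (t : κ → ℝ) :
    ℓ (∑ j, t j • w j) (dirDeriv (w j) f) = ℓ' (∑ j, t j • w' j) (dirDeriv (w' j) f') := by
  classical
  refine sub_eq_zero.1 ((Module.forall_dual_apply_eq_zero_iff ℝ _).1 fun ψ => ?_)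
  rw [map_sub, sub_eq_zero]
  refine HasDerivAt.unique (hℓ ψ f (∑ j, t j • w j) (w j)) ?_
  refine HasDerivAt.congr_of_eventuallyEq (hℓ' ψ f' (∑ j, t j • w' j) (w' j))
    (Filter.Eventually.of_forall fun r => ?_)
  have h1 := h (t + r • (Pi.single j (1 : ℝ) : κ → ℝ))
  rw [sum_add_single_smul, sum_add_single_smul] at h1
  exact congrArg ψ h1

/-- An identity that holds for all t may be differentiated repeatedly in t, so all powers of the two
operators agree on the pair `f`, `f'`. The induction must range over all such pairs, since each step
replaces them by their directional derivatives. -/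
theorem IsTranslationFamily.nilExp_eq {κ : Type*} [Fintype κ]
    {ℓ : E → SmoothFn E →ₗ[ℝ] W} {ℓ' : E' → SmoothFn E' →ₗ[ℝ] W} (hℓ : IsTranslationFamily ℓ)
    (hℓ' : IsTranslationFamily ℓ') {w : κ → E} {w' : κ → E'} {b : κ → W}
    (hb : ∀ i, IsNilpotent (b i)) {f : SmoothFn E} {f' : SmoothFn E'}
    (h : ∀ t : κ → ℝ, ℓ (∑ j, t j • w j) f = ℓ' (∑ j, t j • w' j) f') :
    _root_.nilExp (_root_.taylorOp w b) (ℓ 0) f =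
      _root_.nilExp (_root_.taylorOp w' b) (ℓ' 0) f' := by
  have key : ∀ (k : ℕ) (f : SmoothFn E) (f' : SmoothFn E'),
      (∀ t : κ → ℝ, ℓ (∑ j, t j • w j) f = ℓ' (∑ j, t j • w' j) f') →
      (_root_.taylorOp w b ^ k) (ℓ 0) f = (_root_.taylorOp w' b ^ k) (ℓ' 0) f' := by
    intro k
    induction k with
    | zero => intro f f' h; simpa using h 0
    | succ k ih =>
      intro f f' h
      rw [pow_succ', pow_succ', Module.End.mul_apply, Module.End.mul_apply, taylorOp_apply,
        taylorOp_apply]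
      exact Finset.sum_congr rfl fun j _ => by
        rw [ih _ _ fun t => hℓ.dirDeriv_eq hℓ' h j t]
  obtain ⟨N, hN⟩ := isNilpotent_taylorOp w hb
  obtain ⟨N', hN'⟩ := isNilpotent_taylorOp w' hb
  rw [nilExp_eq_sum (pow_eq_zero_of_le (le_max_left N N') hN),
    nilExp_eq_sum (pow_eq_zero_of_le (le_max_right N N') hN')]
  simp only [LinearMap.sum_apply, LinearMap.smul_apply, key _ f f' h]

/-- If two smooth functions have, at all parameters `t`, the same value at nilpotent tuples `a` and
`a'` in one group of variables, then they have the same value after a further nilpotent tuple is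
substituted for the parameters. -/
theorem nilExp_taylorOp_add_eq {n n' m : ℕ} {v : Fin n → E} {v' : Fin n' → E'} {w : Fin m → E}
    {w' : Fin m → E'} {a : Fin n → W} {a' : Fin n' → W} {b : Fin m → W}
    (ha : ∀ i, IsNilpotent (a i)) (ha' : ∀ i, IsNilpotent (a' i)) (hb : ∀ i, IsNilpotent (b i))
    {f : SmoothFn E} {f' : SmoothFn E'}
    (h : ∀ t : Fin m → ℝ, taylorEval (fun s => f.1 (∑ j, t j • w j + ∑ i, s i • v i)) a =
      taylorEval (fun s => f'.1 (∑ j, t j • w' j + ∑ i, s i • v' i)) a') :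
    nilExp (taylorOp w b + taylorOp v a) (evalFunctional W 0) f =
      nilExp (taylorOp w' b + taylorOp v' a') (evalFunctional W 0) f' := by
  -- Commuting exponentials factor: the inner one evaluates at `a` for each parameter t, where the
  -- hypothesis applies, and the outer one substitutes `b` for t.
  rw [nilExp_add_of_commute (taylorOp_commute _ _ _ _) (isNilpotent_taylorOp w hb)
      (isNilpotent_taylorOp v ha),
    nilExp_add_of_commute (taylorOp_commute _ _ _ _) (isNilpotent_taylorOp w' hb)
      (isNilpotent_taylorOp v' ha')]
  refine (isTranslationFamily_evalFunctional.nilExp v ha).nilExp_eq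
    (isTranslationFamily_evalFunctional.nilExp v' ha') hb fun t => ?_
  rw [← taylorEval_affine _ _ ha, ← taylorEval_affine _ _ ha', h t]

end TaylorOperators

/-! ### Weil prolongation preserves binary products -/

section WeilProduct

variable {X : Type u} {Y : Type v} [Frolicher X] [Frolicher Y]
  {W : Type} [CommRing W] [Algebra ℝ W]

theorem contDiff_of_mem_functions_prod {n m : ℕ} {f : (Fin n → ℝ) × (Fin m → ℝ) → ℝ}
    (hf : f ∈ functions (X := (Fin n → ℝ) × (Fin m → ℝ))) : ContDiff ℝ ∞ f :=
  contDiff_of_contDiff_comp_curve fun c hc => (mem_functions_iff f).1 hf c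
    ⟨mem_curves_pi_real.2 (contDiff_fst.comp hc), mem_curves_pi_real.2 (contDiff_snd.comp hc)⟩

/-- The diagonal direction (eᵢ, eᵢ) is the sum of (0, eᵢ) and (eᵢ, 0), and the operator is additive
in the directions. This separates the two slots of `K`. -/
theorem taylorEval_diagonal {n : ℕ} {a : Fin n → W} (ha : ∀ i, IsNilpotent (a i))
    (K : SmoothFn ((Fin n → ℝ) × (Fin n → ℝ))) :
    taylorEval (fun s => K.1 (s, s)) a =
      nilExp (taylorOp (fun i => ((0 : Fin n → ℝ), (Pi.single i 1 : Fin n → ℝ))) a +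
        taylorOp (fun i => ((Pi.single i 1 : Fin n → ℝ), (0 : Fin n → ℝ))) a)
        (evalFunctional W 0) K := by
  rw [← taylorOp_add, ← taylorEval_affine _ _ ha]
  refine congrArg (fun h => taylorEval h a) (funext fun s => congrArg K.1 ?_)
  rw [zero_add]
  ext j
  · simp [Prod.fst_sum, Finset.sum_apply, Pi.single_apply]
  · simp [Prod.snd_sum, Finset.sum_apply, Pi.single_apply]

theorem sum_smul_inl_add_inr {n m : ℕ} (s : Fin n → ℝ) (t : Fin m → ℝ) :
    ∑ j, t j • ((0 : Fin n → ℝ), (Pi.single j 1 : Fin m → ℝ)) +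
      ∑ i, s i • ((Pi.single i 1 : Fin n → ℝ), (0 : Fin m → ℝ)) = (s, t) := by
  ext j
  · simp [Prod.fst_sum, Finset.sum_apply, Pi.single_apply]
  · simp [Prod.snd_sum, Finset.sum_apply, Pi.single_apply]

/-- A point of `(X × Y) ⊗ W` is determined by its components in `X ⊗ W` and `Y ⊗ W`. -/
theorem WeilProl.mapLeft_fst_snd_injective {p q : WeilProl (X × Y) W}
    (h₁ : mapLeft ⟨Prod.fst, isSmooth_fst⟩ p = mapLeft ⟨Prod.fst, isSmooth_fst⟩ q)
    (h₂ : mapLeft ⟨Prod.snd, isSmooth_snd⟩ p = mapLeft ⟨Prod.snd, isSmooth_snd⟩ q) : p = q := by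
  obtain ⟨⟨n, a, ha, f⟩⟩ := p
  obtain ⟨⟨m, b, hb, g⟩⟩ := q
  have e₁ := Quotient.exact h₁
  have e₂ := Quotient.exact h₂
  refine Quotient.sound ⟨Prod.ext e₁.1 e₂.1, fun χ hχ => ?_⟩
  have hX : ∀ {k l : ℕ} (u : SmoothMap (Fin k → ℝ) (X × Y)) (v : SmoothMap (Fin l → ℝ) (X × Y)),
      ContDiff ℝ ∞ fun z : (Fin k → ℝ) × (Fin l → ℝ) => χ ((u z.1).1, (v z.2).2) := by
    intro k l u v
    have h : IsSmooth fun z : (Fin k → ℝ) × (Fin l → ℝ) => ((u z.1).1, (v z.2).2) :=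
      (isSmooth_fst.comp (u.smooth.comp isSmooth_fst)).prodMk
        (isSmooth_snd.comp (v.smooth.comp isSmooth_snd))
    exact contDiff_of_mem_functions_prod (h.comp_mem_functions hχ)
  -- Interpolation between χ(f₁, f₂) and χ(g₁, g₂) through χ(g₁, f₂), with independent variables in
  -- the two slots. In each exchange the other slot is frozen at a parameter t, so that χ becomes a
  -- structure function of a single factor and the hypothesis on that component applies for every t.
  let K₁ : SmoothFn ((Fin n → ℝ) × (Fin n → ℝ)) := ⟨_, hX f f⟩
  let K₂ : SmoothFn ((Fin m → ℝ) × (Fin n → ℝ)) := ⟨_, hX g f⟩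
  let K₃ : SmoothFn ((Fin m → ℝ) × (Fin m → ℝ)) := ⟨_, hX g g⟩
  refine (taylorEval_diagonal ha K₁).trans (Eq.trans ?_ (taylorEval_diagonal hb K₃).symm)
  have h12 : nilExp (taylorOp (fun i => ((0 : Fin n → ℝ), (Pi.single i 1 : Fin n → ℝ))) a +
        taylorOp (fun i => ((Pi.single i 1 : Fin n → ℝ), (0 : Fin n → ℝ))) a)
        (evalFunctional W 0) K₁ =
      nilExp (taylorOp (fun i => ((0 : Fin m → ℝ), (Pi.single i 1 : Fin n → ℝ))) a +
        taylorOp (fun i => ((Pi.single i 1 : Fin m → ℝ), (0 : Fin n → ℝ))) b)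
        (evalFunctional W 0) K₂ := by
    refine nilExp_taylorOp_add_eq ha hb ha fun t => ?_
    simp only [sum_smul_inl_add_inr]
    exact e₁.2 (fun x => χ (x, (f t).2)) ((isSmooth_id.prodMk
      (isSmooth_const (f t).2)).comp_mem_functions hχ)
  have h23 : nilExp (taylorOp (fun i => ((Pi.single i 1 : Fin m → ℝ), (0 : Fin n → ℝ))) b +
        taylorOp (fun i => ((0 : Fin m → ℝ), (Pi.single i 1 : Fin n → ℝ))) a)
        (evalFunctional W 0) K₂ =
      nilExp (taylorOp (fun i => ((Pi.single i 1 : Fin m → ℝ), (0 : Fin m → ℝ))) b +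
        taylorOp (fun i => ((0 : Fin m → ℝ), (Pi.single i 1 : Fin m → ℝ))) b)
        (evalFunctional W 0) K₃ := by
    refine nilExp_taylorOp_add_eq ha hb hb fun t => ?_
    simp only [add_comm (∑ j, t j • _), sum_smul_inl_add_inr]
    exact e₂.2 (fun y => χ ((g t).1, y)) (((isSmooth_const (g t).1).prodMk
      isSmooth_id).comp_mem_functions hχ)
  rw [h12, add_comm, h23, add_comm]

/-- Both sides are the exponential of the same operator, applied to evaluation at 0. It serves to
add or delete variables that do not matter. -/
theorem taylorEval_reindex {n m : ℕ} {a : Fin n → W} {b : Fin m → W}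
    (ha : ∀ i, IsNilpotent (a i)) (hb : ∀ i, IsNilpotent (b i)) (v : Fin n → Fin m → ℝ)
    (hv : taylorOp v a = taylorOp (fun i => (Pi.single i 1 : Fin m → ℝ)) b)
    {h : (Fin m → ℝ) → ℝ} (hh : ContDiff ℝ ∞ h) :
    taylorEval (fun s => h (∑ i, s i • v i)) a = taylorEval h b := by
  have h1 := taylorEval_affine 0 v ha ⟨h, hh⟩
  have h2 := taylorEval_affine 0 (fun i => (Pi.single i 1 : Fin m → ℝ)) hb ⟨h, hh⟩
  rw [hv, ← h2] at h1
  simp only [zero_add] at h1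
  rw [h1]
  refine congrArg (fun h => taylorEval h b) (funext fun s => congrArg h (funext fun j => ?_))
  simp [Finset.sum_apply, Pi.single_apply]

theorem taylorOp_zero_smul {E : Type*} [NormedAddCommGroup E] [NormedSpace ℝ E] (a : W) :
    a • dualDeriv W (0 : E) = 0 := by
  refine LinearMap.ext fun ℓ => LinearMap.ext fun f => ?_
  have : dirDeriv (0 : E) f = 0 := Subtype.ext <| funext fun x => by simp [dirDeriv]
  simp [dualDeriv_apply, this]

theorem isNilpotent_append {R : Type*} [CommRing R] {n m : ℕ} {a : Fin n → R} {b : Fin m → R}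
    (ha : ∀ i, IsNilpotent (a i)) (hb : ∀ i, IsNilpotent (b i)) (i : Fin (n + m)) :
    IsNilpotent (Fin.append a b i) := by
  refine Fin.addCases (fun i => ?_) (fun i => ?_) i
  · simpa using ha i
  · simpa using hb i

/-- The projection of `ℝⁿ⁺ᵐ` to its first `n` coordinates. -/
def projLeft (n m : ℕ) : SmoothMap (Fin (n + m) → ℝ) (Fin n → ℝ) :=
  ⟨fun x i => x (Fin.castAdd m i), fun _ hc _ => hc _⟩

/-- The projection of `ℝⁿ⁺ᵐ` to its last `m` coordinates. -/
def projRight (n m : ℕ) : SmoothMap (Fin (n + m) → ℝ) (Fin m → ℝ) :=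
  ⟨fun x i => x (Fin.natAdd n i), fun _ hc _ => hc _⟩

theorem SmoothMap.contDiff_comp_of_mem_functions {n : ℕ} (f : SmoothMap (Fin n → ℝ) X) {χ : X → ℝ}
    (hχ : χ ∈ functions (X := X)) : ContDiff ℝ ∞ fun x => χ (f x) :=
  contDiff_of_mem_functions (f.smooth.comp_mem_functions hχ)

/-- The projection is the linear map that sends the last m basis vectors to 0; their terms in the
operator vanish, whatever the values `b`. -/
theorem WeilProl.mk_append_projLeft {n m : ℕ} {a : Fin n → W} {b : Fin m → W}
    (ha : ∀ i, IsNilpotent (a i)) (hb : ∀ i, IsNilpotent (b i)) (f : SmoothMap (Fin n → ℝ) X) :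
    mk (Fin.append a b) (isNilpotent_append ha hb) (f.comp (projLeft n m)) = mk a ha f := by
  refine Quotient.sound ⟨rfl, fun χ hχ => ?_⟩
  let v : Fin (n + m) → Fin n → ℝ := Fin.append (fun i => Pi.single i 1) fun _ => 0
  have hv : taylorOp v (Fin.append a b) =
      taylorOp (fun i => (Pi.single i 1 : Fin n → ℝ)) a := by
    simp [taylorOp, Fin.sum_univ_add, v, taylorOp_zero_smul]
  rw [← taylorEval_reindex (isNilpotent_append ha hb) ha v hv
    (f.contDiff_comp_of_mem_functions hχ)]
  refine congrArg (fun h => taylorEval h (Fin.append a b))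
    (funext fun x => congrArg (fun y => χ (f y)) (funext fun j => ?_))
  simp [Fin.sum_univ_add, v, Finset.sum_apply, Pi.single_apply]
  rfl

theorem WeilProl.mk_append_projRight {n m : ℕ} {a : Fin n → W} {b : Fin m → W}
    (ha : ∀ i, IsNilpotent (a i)) (hb : ∀ i, IsNilpotent (b i)) (f : SmoothMap (Fin m → ℝ) X) :
    mk (Fin.append a b) (isNilpotent_append ha hb) (f.comp (projRight n m)) = mk b hb f := by
  refine Quotient.sound ⟨rfl, fun χ hχ => ?_⟩
  let v : Fin (n + m) → Fin m → ℝ := Fin.append (fun _ => 0) fun i => Pi.single i 1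
  have hv : taylorOp v (Fin.append a b) =
      taylorOp (fun i => (Pi.single i 1 : Fin m → ℝ)) b := by
    simp [taylorOp, Fin.sum_univ_add, v, taylorOp_zero_smul]
  rw [← taylorEval_reindex (isNilpotent_append ha hb) hb v hv
    (f.contDiff_comp_of_mem_functions hχ)]
  refine congrArg (fun h => taylorEval h (Fin.append a b))
    (funext fun x => congrArg (fun y => χ (f y)) (funext fun j => ?_))
  simp [Fin.sum_univ_add, v, Finset.sum_apply, Pi.single_apply]
  rfl

theorem WeilProl.isSmooth_mk {n : ℕ} (a : Fin n → W) (ha : ∀ i, IsNilpotent (a i)) :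
    IsSmooth (mk (X := X) a ha) :=
  fun γ hγ => mem_ofCurves ⟨n, a, ha, γ, hγ, rfl⟩

/-- The map `C^∞(ℝⁿ, X) × C^∞(ℝᵐ, Y) → C^∞(ℝⁿ⁺ᵐ, X × Y)`. -/
def SmoothMap.juxtapose {n m : ℕ} (f : SmoothMap (Fin n → ℝ) X) (g : SmoothMap (Fin m → ℝ) Y) :
    SmoothMap (Fin (n + m) → ℝ) (X × Y) :=
  ⟨fun x => (f (projLeft n m x), g (projRight n m x)),
    (f.smooth.comp (projLeft n m).smooth).prodMk (g.smooth.comp (projRight n m).smooth)⟩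

theorem SmoothMap.isSmooth_juxtapose {n m : ℕ} {γ : ℝ → SmoothMap (Fin n → ℝ) X}
    (hγ : γ ∈ curves (X := SmoothMap (Fin n → ℝ) X)) {δ : ℝ → SmoothMap (Fin m → ℝ) Y}
    (hδ : δ ∈ curves (X := SmoothMap (Fin m → ℝ) Y)) :
    IsSmooth fun p : ℝ × ℝ => (γ p.1).juxtapose (δ p.2) := by
  have h₁ := isSmooth_uncurry_of_mem_curves hγ
  have h₂ := isSmooth_uncurry_of_mem_curves hδ
  have h : IsSmooth fun z : (Fin (n + m) → ℝ) × (ℝ × ℝ) =>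
      (γ z.2.1 (projLeft n m z.1), δ z.2.2 (projRight n m z.1)) :=
    (h₁.comp ((isSmooth_fst.comp isSmooth_snd).prodMk
      ((projLeft n m).smooth.comp isSmooth_fst))).prodMk
    (h₂.comp ((isSmooth_snd.comp isSmooth_snd).prodMk
      ((projRight n m).smooth.comp isSmooth_fst)))
  exact SmoothMap.isSmooth_curry h

theorem WeilProl.exists_curve (p : WeilProl X W) :
    ∃ c ∈ {c : ℝ → WeilProl X W | ∃ (n : ℕ) (a : Fin n → W) (ha : ∀ i, IsNilpotent (a i)),
      ∃ γ ∈ curves (X := SmoothMap (Fin n → ℝ) X), c = mk a ha ∘ γ}, ∃ t, c t = p := by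
  obtain ⟨⟨n, a, ha, f⟩⟩ := p
  exact ⟨_, ⟨n, a, ha, _, const_mem_curves f, rfl⟩, 0, rfl⟩

/-- The map `(X ⊗ W) × (Y ⊗ W) → (X × Y) ⊗ W`. -/
def WeilProl.pair (p : WeilProl X W × WeilProl Y W) : WeilProl (X × Y) W :=
  mk _ (isNilpotent_append p.1.out.nil p.2.out.nil) (p.1.out.f.juxtapose p.2.out.f)

theorem WeilProl.mapLeft_fst_pair (p : WeilProl X W × WeilProl Y W) :
    mapLeft ⟨Prod.fst, isSmooth_fst⟩ (pair p) = p.1 :=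
  (mk_append_projLeft p.1.out.nil p.2.out.nil p.1.out.f).trans (Quotient.out_eq p.1)

theorem WeilProl.mapLeft_snd_pair (p : WeilProl X W × WeilProl Y W) :
    mapLeft ⟨Prod.snd, isSmooth_snd⟩ (pair p) = p.2 :=
  (mk_append_projRight p.1.out.nil p.2.out.nil p.2.out.f).trans (Quotient.out_eq p.2)

/-- `pair` is defined through chosen representatives. A point of (X × Y) ⊗ W is determined by its
components, so any representatives give the same result, which makes smoothness on generating curves
visible. -/
theorem WeilProl.pair_mk {n m : ℕ} {a : Fin n → W} {b : Fin m → W}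
    (ha : ∀ i, IsNilpotent (a i)) (hb : ∀ i, IsNilpotent (b i)) (f : SmoothMap (Fin n → ℝ) X)
    (g : SmoothMap (Fin m → ℝ) Y) :
    pair (mk a ha f, mk b hb g) = mk _ (isNilpotent_append ha hb) (f.juxtapose g) :=
  mapLeft_fst_snd_injective
    ((mapLeft_fst_pair _).trans (mk_append_projLeft ha hb f).symm)
    ((mapLeft_snd_pair _).trans (mk_append_projRight ha hb g).symm)

/-- It suffices to test on independent pairs of generating curves, and these lift to smooth
two-parameter families of juxtaposed maps. -/
theorem WeilProl.isSmooth_pair : IsSmooth (pair (X := X) (Y := Y) (W := W)) := by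
  refine Frolicher.isSmooth_prod_ofCurves exists_curve exists_curve ?_
  rintro _ ⟨n, a, ha, γ, hγ, rfl⟩ _ ⟨m, b, hb, δ, hδ, rfl⟩
  simp only [Function.comp_apply, pair_mk]
  exact (isSmooth_mk _ _).comp (SmoothMap.isSmooth_juxtapose hγ hδ)

end WeilProduct

/-! ### Products of Weil exponentiable and microlinear spaces -/

section PointwiseProducts

variable {K C J : Type*} [Category K] [Category C] [Category J]

/-- Two functors that are pointwise products of isomorphic pairs of functors are isomorphic. -/
def natIsoOfPointwiseProducts {A A₁ A₂ B B₁ B₂ : K ⥤ C} {p₁ : A ⟶ A₁} {p₂ : A ⟶ A₂}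
    {q₁ : B ⟶ B₁} {q₂ : B ⟶ B₂} (hA : ∀ T, IsLimit (BinaryFan.mk (p₁.app T) (p₂.app T)))
    (hB : ∀ T, IsLimit (BinaryFan.mk (q₁.app T) (q₂.app T))) (e₁ : A₁ ≅ B₁) (e₂ : A₂ ≅ B₂) :
    A ≅ B :=
  have hom_fst : ∀ T, ((hA T).conePointsIsoOfNatIso (hB T)
      (mapPairIso (e₁.app T) (e₂.app T))).hom ≫ q₁.app T = p₁.app T ≫ e₁.hom.app T := fun T =>
    IsLimit.conePointsIsoOfNatIso_hom_comp (hA T) (hB T) _ ⟨WalkingPair.left⟩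
  have hom_snd : ∀ T, ((hA T).conePointsIsoOfNatIso (hB T)
      (mapPairIso (e₁.app T) (e₂.app T))).hom ≫ q₂.app T = p₂.app T ≫ e₂.hom.app T := fun T =>
    IsLimit.conePointsIsoOfNatIso_hom_comp (hA T) (hB T) _ ⟨WalkingPair.right⟩
  NatIso.ofComponents
    (fun T => (hA T).conePointsIsoOfNatIso (hB T) (mapPairIso (e₁.app T) (e₂.app T)))
    fun {T T'} f => BinaryFan.IsLimit.hom_ext (hB T')
      (by
        change (_ ≫ _) ≫ q₁.app T' = (_ ≫ _) ≫ q₁.app T'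
        rw [Category.assoc, hom_fst, Category.assoc, q₁.naturality, reassoc_of% (hom_fst T),
          p₁.naturality_assoc, e₁.hom.naturality])
      (by
        change (_ ≫ _) ≫ q₂.app T' = (_ ≫ _) ≫ q₂.app T'
        rw [Category.assoc, hom_snd, Category.assoc, q₂.naturality, reassoc_of% (hom_snd T),
          p₂.naturality_assoc, e₂.hom.naturality])

/-- A pointwise product of two functors that send a cone to a limit cone does so, too. -/
def isLimitMapConeOfPointwiseProduct {P F G : K ⥤ C} {p₁ : P ⟶ F} {p₂ : P ⟶ G}
    (hP : ∀ T, IsLimit (BinaryFan.mk (p₁.app T) (p₂.app T))) {D : J ⥤ K} {c : Cone D}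
    (hF : IsLimit (F.mapCone c)) (hG : IsLimit (G.mapCone c)) : IsLimit (P.mapCone c) :=
  let s₁ : Cone (D ⋙ P) → Cone (D ⋙ F) := fun s =>
    (Cone.postcompose (Functor.whiskerLeft D p₁)).obj s
  let s₂ : Cone (D ⋙ P) → Cone (D ⋙ G) := fun s =>
    (Cone.postcompose (Functor.whiskerLeft D p₂)).obj s
  let l : ∀ s : Cone (D ⋙ P), {l : s.pt ⟶ P.obj c.pt // l ≫ p₁.app c.pt = hF.lift (s₁ s) ∧
      l ≫ p₂.app c.pt = hG.lift (s₂ s)} := fun s =>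
    BinaryFan.IsLimit.lift' (hP c.pt) (hF.lift (s₁ s)) (hG.lift (s₂ s))
  { lift := fun s => (l s).1
    fac := fun s j => BinaryFan.IsLimit.hom_ext (hP (D.obj j))
      (by
        change ((l s).1 ≫ P.map (c.π.app j)) ≫ p₁.app _ = s.π.app j ≫ p₁.app _
        rw [Category.assoc, p₁.naturality, reassoc_of% (l s).2.1]
        exact hF.fac (s₁ s) j)
      (by
        change ((l s).1 ≫ P.map (c.π.app j)) ≫ p₂.app _ = s.π.app j ≫ p₂.app _
        rw [Category.assoc, p₂.naturality, reassoc_of% (l s).2.2]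
        exact hG.fac (s₂ s) j)
    uniq := fun s m hm => BinaryFan.IsLimit.hom_ext (hP c.pt)
      (by
        change m ≫ p₁.app _ = (l s).1 ≫ p₁.app _
        rw [(l s).2.1]
        refine hF.uniq (s₁ s) _ fun j => ?_
        change (m ≫ p₁.app _) ≫ F.map (c.π.app j) = s.π.app j ≫ p₁.app _
        rw [← hm j, Category.assoc, ← p₁.naturality, Category.assoc]
        rfl)
      (by
        change m ≫ p₂.app _ = (l s).1 ≫ p₂.app _
        rw [(l s).2.2]
        refine hG.uniq (s₂ s) _ fun j => ?_
        change (m ≫ p₂.app _) ≫ G.map (c.π.app j) = s.π.app j ≫ p₂.app _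
        rw [← hm j, Category.assoc, ← p₂.naturality, Category.assoc]
        rfl) }

end PointwiseProducts

namespace FS

theorem isIso_prodComparison_weil (W : WeilAlg) (X Y : FS.{u}) :
    IsIso (CartesianMonoidalCategory.prodComparison (weil.flip.obj W) X Y) :=
  ⟨(⟨WeilProl.pair, WeilProl.isSmooth_pair⟩ :
      SmoothMap (WeilProl X W.obj × WeilProl Y W.obj) (WeilProl (X × Y) W.obj)),
    SmoothMap.ext <| funext fun _ => WeilProl.mapLeft_fst_snd_injective
      (WeilProl.mapLeft_fst_pair _) (WeilProl.mapLeft_snd_pair _),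
    SmoothMap.ext <| funext fun p =>
      Prod.ext (WeilProl.mapLeft_fst_pair p) (WeilProl.mapLeft_snd_pair p)⟩

instance preservesBinaryProducts_weil (W : WeilAlg) :
    PreservesLimitsOfShape (Discrete WalkingPair) (weil.{u}.flip.obj W) :=
  have := isIso_prodComparison_weil.{u} W
  preservesLimitsOfShape_discrete_walkingPair_of_isIso_prodComparison _

instance isRightAdjoint_exp (Y : FS.{u}ᵒᵖ) : (expFunctor.obj Y).IsRightAdjoint :=
  ⟨_, ⟨expAdjunction Y.unop⟩⟩

/-- `X ↦ (X ⊗ (W₁ ⊗ W₂))^Y`. -/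
abbrev expOfWeilAt (T : FS.{u}ᵒᵖ × (WeilAlg × WeilAlg)) : FS.{u} ⥤ FS.{u} :=
  weil.flip.obj (T.2.1 ⊗ T.2.2) ⋙ expFunctor.obj T.1

/-- `X ↦ (X ⊗ W₁)^Y ⊗ W₂`. -/
abbrev weilOfExpAt (T : FS.{u}ᵒᵖ × (WeilAlg × WeilAlg)) : FS.{u} ⥤ FS.{u} :=
  (weil.flip.obj T.2.1 ⋙ expFunctor.obj T.1) ⋙ weil.flip.obj T.2.2

/-- Functoriality of `X ↦ (Y, W₁, W₂) ↦ (X ⊗ (W₁ ⊗ W₂))^Y`. -/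
def expOfWeilMap {X X' : FS.{u}} (g : X ⟶ X') : expOfWeil X ⟶ expOfWeil X' where
  app T := (expOfWeilAt T).map g
  naturality _ _ f := SmoothMap.ext <| funext fun k => SmoothMap.ext <| funext fun z =>
    congrArg (fun φ : SmoothMap _ _ => φ (SmoothMap.toFun k (f.1.unop z)))
      ((weil.map g).naturality (f.2.1 ⊗ₘ f.2.2))

/-- Functoriality of `X ↦ (Y, W₁, W₂) ↦ (X ⊗ W₁)^Y ⊗ W₂`. -/
def weilOfExpMap {X X' : FS.{u}} (g : X ⟶ X') : weilOfExp X ⟶ weilOfExp X' where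
  app T := (weilOfExpAt T).map g
  naturality _ _ f := SmoothMap.ext <| funext <| by
    rintro ⟨⟨n, a, ha, k⟩⟩
    refine congrArg (WeilProl.mk (f.2.2.hom.hom ∘ a) fun i => (ha i).map _)
      (SmoothMap.ext <| funext fun s => SmoothMap.ext <| funext fun z => ?_)
    exact congrArg
      (fun φ : SmoothMap _ _ => φ (SmoothMap.toFun (SmoothMap.toFun k s) (f.1.unop z)))
      ((weil.map g).naturality f.2.1)

/-- For fixed (Y, W₁, W₂) both sides preserve binary products in X, being composites of
prolongations and right adjoints. The isomorphisms for the two factors therefore combine, and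
naturality is checked after projection. -/
theorem WeilExponentiable.prod {X Y : FS.{u}} (hX : WeilExponentiable X)
    (hY : WeilExponentiable Y) : WeilExponentiable (X ⊗ Y) := by
  obtain ⟨eX⟩ := hX
  obtain ⟨eY⟩ := hY
  exact ⟨natIsoOfPointwiseProducts (p₁ := expOfWeilMap (fst X Y)) (p₂ := expOfWeilMap (snd X Y))
    (q₁ := weilOfExpMap (fst X Y)) (q₂ := weilOfExpMap (snd X Y))
    (fun T => isLimitCartesianMonoidalCategoryOfPreservesLimits (expOfWeilAt T) X Y)
    (fun T => isLimitCartesianMonoidalCategoryOfPreservesLimits (weilOfExpAt T) X Y) eX eY⟩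

theorem Microlinear.prod {X Y : FS.{u}} (hX : Microlinear X) (hY : Microlinear Y) :
    Microlinear (X ⊗ Y) := by
  intro J _ _ D c hc
  obtain ⟨hF⟩ := hX J D c hc
  obtain ⟨hG⟩ := hY J D c hc
  exact ⟨isLimitMapConeOfPointwiseProduct (p₁ := weil.map (fst X Y)) (p₂ := weil.map (snd X Y))
    (fun W => isLimitCartesianMonoidalCategoryOfPreservesLimits (weil.flip.obj W) X Y) hF hG⟩

end FS

/-! ### Prolongation by ℝ and the one-point space -/

section ReducedWeil

variable {X : Type u} [Frolicher X] {W : Type} [CommRing W] [Algebra ℝ W]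

theorem taylorEval_const {n : ℕ} (a : Fin n → W) (ha : ∀ i, IsNilpotent (a i)) (c : ℝ) :
    taylorEval (fun _ => c) a = algebraMap ℝ W c := by
  -- A constant is its own pullback along the zero directions, for which the operator is 0 and its
  -- exponential is 1.
  refine (taylorEval_affine (0 : ℝ) (fun _ => 0) ha
    ⟨fun _ => c, (contDiff_const : ContDiff ℝ ∞ fun _ : ℝ => c)⟩).trans ?_
  have h : taylorOp (fun _ : Fin n => (0 : ℝ)) a = 0 :=
    Finset.sum_eq_zero fun i _ => taylorOp_zero_smul (a i)
  rw [h, nilExp_eq_sum (pow_one 0)]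
  simp [evalFunctional_apply]

theorem taylorEval_eq_of_isReduced [IsReduced W] {n : ℕ} (a : Fin n → W)
    (ha : ∀ i, IsNilpotent (a i)) {h : (Fin n → ℝ) → ℝ} (hh : ContDiff ℝ ∞ h) :
    taylorEval h a = algebraMap ℝ W (h 0) := by
  have h1 : taylorOp (fun i => (Pi.single i 1 : Fin n → ℝ)) a =
      taylorOp (fun _ => (0 : Fin n → ℝ)) a :=
    Finset.sum_congr rfl fun i _ => by rw [(ha i).eq_zero, zero_smul, zero_smul]
  rw [← taylorEval_reindex ha ha _ h1.symm hh]
  simp only [smul_zero, Finset.sum_const_zero]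
  exact taylorEval_const a ha _

/-- The map `X → X ⊗ W` given by constant maps. -/
def WeilProl.const (x : X) : WeilProl X W :=
  mk (n := 0) Fin.elim0 (fun i => i.elim0) ⟨fun _ => x, isSmooth_const x⟩

theorem WeilProl.isSmooth_const : IsSmooth (const (X := X) (W := W)) :=
  (isSmooth_mk _ _).comp (SmoothMap.isSmooth_curry (Y := Fin 0 → ℝ) isSmooth_snd)

/-- The base point projection `X ⊗ W → X`. -/
def WeilProl.base (p : WeilProl X W) : X :=
  Quotient.lift (fun p : WeilRep X W => p.f 0) (fun p q (h : (weilSetoid X W).r p q) => h.1) p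

theorem WeilProl.isSmooth_base : IsSmooth (base (X := X) (W := W)) := by
  refine isSmooth_ofCurves _ ?_
  rintro _ ⟨n, a, ha, γ, hγ, rfl⟩
  exact SmoothMap.isSmooth_eval (fun t => ((0 : Fin n → ℝ), γ t)) ⟨const_mem_curves _, hγ⟩

theorem WeilProl.const_base [IsReduced W] (p : WeilProl X W) : const (base p) = p := by
  obtain ⟨⟨n, a, ha, f⟩⟩ := p
  refine Quotient.sound ⟨rfl, fun χ hχ => ?_⟩
  refine (taylorEval_const _ (fun i => i.elim0) (χ (f 0))).trans ?_
  exact (taylorEval_eq_of_isReduced a ha (f.contDiff_comp_of_mem_functions hχ)).symm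

instance WeilProl.subsingleton [Subsingleton X] : Subsingleton (WeilProl X W) where
  allEq := by
    rintro ⟨⟨n, a, ha, f⟩⟩ ⟨⟨m, b, hb, g⟩⟩
    refine Quotient.sound ⟨Subsingleton.elim _ _, fun χ hχ => ?_⟩
    have hf : (fun x => χ (f x)) = fun _ => χ (f 0) :=
      funext fun x => congrArg χ (Subsingleton.elim _ _)
    have hg : (fun x => χ (g x)) = fun _ => χ (f 0) :=
      funext fun x => congrArg χ (Subsingleton.elim _ _)
    change taylorEval (fun x => χ (f x)) a = taylorEval (fun x => χ (g x)) b
    rw [hf, hg, taylorEval_const a ha, taylorEval_const b hb]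

instance WeilProl.nonempty [h : Nonempty X] : Nonempty (WeilProl X W) := h.map const

instance SmoothMap.subsingleton {Y : Type v} [Frolicher Y] [Subsingleton X] :
    Subsingleton (SmoothMap Y X) where
  allEq _ _ := SmoothMap.ext (Subsingleton.elim _ _)

instance SmoothMap.nonempty {Y : Type v} [Frolicher Y] [h : Nonempty X] :
    Nonempty (SmoothMap Y X) :=
  h.map fun x => ⟨fun _ => x, Frolicher.isSmooth_const x⟩

end ReducedWeil

namespace FS

/-- Any two one-point spaces are isomorphic. -/
def isoOfSubsingleton (A B : FS.{u}) [Subsingleton A] [Subsingleton B] [Nonempty A] [Nonempty B] :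
    A ≅ B where
  hom := (⟨fun _ => Classical.arbitrary B, isSmooth_const _⟩ : SmoothMap A B)
  inv := (⟨fun _ => Classical.arbitrary A, isSmooth_const _⟩ : SmoothMap B A)
  hom_inv_id := SmoothMap.ext (funext fun _ => Subsingleton.elim (α := A) _ _)
  inv_hom_id := SmoothMap.ext (funext fun _ => Subsingleton.elim (α := B) _ _)

instance subsingleton_unit : Subsingleton (𝟙_ FS.{u}) :=
  inferInstanceAs (Subsingleton PUnit.{u + 1})

instance nonempty_unit : Nonempty (𝟙_ FS.{u}) :=
  inferInstanceAs (Nonempty PUnit.{u + 1})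

/-- Both functors take values in one-point spaces, so naturality is automatic. -/
theorem weilExponentiable_unit : WeilExponentiable (𝟙_ FS.{u}) := by
  have h₁ : ∀ T, Subsingleton ((expOfWeil (𝟙_ FS.{u})).obj T) := fun T =>
    inferInstanceAs (Subsingleton (SmoothMap T.1.unop (WeilProl (𝟙_ FS.{u}) (T.2.1 ⊗ T.2.2).obj)))
  have h₂ : ∀ T, Nonempty ((expOfWeil (𝟙_ FS.{u})).obj T) := fun T =>
    inferInstanceAs (Nonempty (SmoothMap T.1.unop (WeilProl (𝟙_ FS.{u}) (T.2.1 ⊗ T.2.2).obj)))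
  have h₃ : ∀ T, Subsingleton ((weilOfExp (𝟙_ FS.{u})).obj T) := fun T =>
    inferInstanceAs (Subsingleton
      (WeilProl (SmoothMap T.1.unop (WeilProl (𝟙_ FS.{u}) T.2.1.obj)) T.2.2.obj))
  have h₄ : ∀ T, Nonempty ((weilOfExp (𝟙_ FS.{u})).obj T) := fun T =>
    inferInstanceAs (Nonempty
      (WeilProl (SmoothMap T.1.unop (WeilProl (𝟙_ FS.{u}) T.2.1.obj)) T.2.2.obj))
  exact ⟨NatIso.ofComponents (fun T => isoOfSubsingleton _ _) fun {_ T} _ =>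
    SmoothMap.ext (funext fun _ => (h₃ T).elim _ _)⟩

theorem microlinear_unit : Microlinear (𝟙_ FS.{u}) := by
  intro J _ _ D c _
  have h₁ : ∀ W : WeilAlg, Subsingleton (WeilProl (𝟙_ FS.{u}) W.obj) := fun _ => inferInstance
  exact ⟨{
    lift := fun s => (⟨fun _ => Classical.arbitrary (WeilProl (𝟙_ FS.{u}) c.pt.obj),
      isSmooth_const _⟩ : SmoothMap s.pt (WeilProl (𝟙_ FS.{u}) c.pt.obj))
    fac := fun s j => SmoothMap.ext (funext fun _ => (h₁ (D.obj j)).elim _ _)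
    uniq := fun s m _ => SmoothMap.ext (funext fun _ => (h₁ c.pt).elim _ _) }⟩

/-! ### Exponentials of Weil exponentiable and microlinear spaces -/

/-- `X ≅ X ⊗ ℝ`. -/
def weilUnitIso (X : FS.{u}) : X ≅ (weil.obj X).obj (𝟙_ WeilAlg) :=
  have : IsReduced (𝟙_ WeilAlg).obj := inferInstanceAs (IsReduced ℝ)
  { hom := (⟨WeilProl.const, WeilProl.isSmooth_const⟩ : SmoothMap X (WeilProl X (𝟙_ WeilAlg).obj))
    inv := (⟨WeilProl.base, WeilProl.isSmooth_base⟩ : SmoothMap (WeilProl X (𝟙_ WeilAlg).obj) X)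
    hom_inv_id := rfl
    inv_hom_id := SmoothMap.ext (funext fun p => WeilProl.const_base p) }

/-- `W ↦ (Y, ℝ, W)`. -/
abbrev unitParameters (Y : FS.{u}) : WeilAlg ⥤ FS.{u}ᵒᵖ × (WeilAlg × WeilAlg) where
  obj W := (Opposite.op Y, 𝟙_ WeilAlg, W)
  map φ := (𝟙 _, 𝟙 _, φ)

/-- `(X ⊗ ℝ)^Y ⊗ W` as a functor of `W`. -/
def unitParametersWeilOfExpIso (X Y : FS.{u}) :
    weil.obj (exp Y ((weil.obj X).obj (𝟙_ WeilAlg))) ≅ unitParameters Y ⋙ weilOfExp X :=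
  NatIso.ofComponents (fun _ => Iso.refl _) fun {W W'} φ => by
    change (weil.obj _).map φ = (weil.map ((expFunctor.map (𝟙 (Opposite.op Y))).app _ ≫
      (expFunctor.obj _).map ((weil.obj X).map (𝟙 (𝟙_ WeilAlg))))).app W ≫ (weil.obj _).map φ
    simp

/-- `(X ⊗ (ℝ ⊗ W))^Y ≅ (X ⊗ W)^Y` as functors of `W`. -/
def unitParametersExpOfWeilIso (X Y : FS.{u}) :
    unitParameters Y ⋙ expOfWeil X ≅ weil.obj X ⋙ expFunctor.obj (Opposite.op Y) :=
  NatIso.ofComponents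
    (fun W => (expFunctor.obj (Opposite.op Y)).mapIso ((weil.obj X).mapIso (λ_ W)))
    fun {W W'} φ => by
      change ((expFunctor.map (𝟙 (Opposite.op Y))).app _ ≫
        (expFunctor.obj (Opposite.op Y)).map ((weil.obj X).map (𝟙 (𝟙_ WeilAlg) ⊗ₘ φ))) ≫
        (expFunctor.obj (Opposite.op Y)).map ((weil.obj X).map (λ_ W').hom) =
        (expFunctor.obj (Opposite.op Y)).map ((weil.obj X).map (λ_ W).hom) ≫
        (expFunctor.obj (Opposite.op Y)).map ((weil.obj X).map φ)
      rw [expFunctor.map_id, NatTrans.id_app, Category.id_comp, ← Functor.map_comp,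
        ← Functor.map_comp, ← Functor.map_comp, ← Functor.map_comp, id_tensorHom,
        leftUnitor_naturality]

/-- For a Weil exponentiable space `X`, Weil prolongation commutes with exponentiation. -/
theorem WeilExponentiable.nonempty_weil_exp_iso {X : FS.{u}} (hX : WeilExponentiable X)
    (Y : FS.{u}) :
    Nonempty (weil.obj (exp Y X) ≅ weil.obj X ⋙ expFunctor.obj (Opposite.op Y)) := by
  obtain ⟨e⟩ := hX
  -- The chain is X^Y ⊗ W ≅ (X ⊗ ℝ)^Y ⊗ W ≅ (X ⊗ (ℝ ⊗ W))^Y ≅ (X ⊗ W)^Y, with Weil exponentiability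
  -- used at W₁ = ℝ.
  exact ⟨weil.mapIso ((expFunctor.obj (Opposite.op Y)).mapIso (weilUnitIso X)) ≪≫
    unitParametersWeilOfExpIso X Y ≪≫ Functor.isoWhiskerLeft (unitParameters Y) e.symm ≪≫
    unitParametersExpOfWeilIso X Y⟩

/-- Prolongation of X^Y is that of X followed by (·)^Y, a right adjoint, which preserves the limit
cones supplied by microlinearity of X. -/
theorem Microlinear.exp {X : FS.{u}} (hX : Microlinear X) (hX' : WeilExponentiable X)
    (Y : FS.{u}) : Microlinear (exp Y X) := by
  intro J _ _ D c hc
  obtain ⟨hF⟩ := hX J D c hc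
  obtain ⟨e⟩ := hX'.nonempty_weil_exp_iso Y
  have : PreservesLimit (D ⋙ weil.obj X) (expFunctor.obj (Opposite.op Y)) :=
    (expAdjunction Y).rightAdjoint_preservesLimits.preservesLimitsOfShape.preservesLimit
  exact ⟨IsLimit.mapConeEquiv e.symm
    (isLimitOfPreserves (expFunctor.obj (Opposite.op Y)) hF)⟩

/-- `(A^Y)^Z ≅ A^(Y × Z)`. -/
def expExpIso (Y Z A : FS.{u}) : exp Z (exp Y A) ≅ exp (Y ⊗ Z) A where
  hom :=
    (⟨fun k => ⟨fun p => k p.2 p.1, SmoothMap.isSmooth_uncurry k.smooth⟩,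
      SmoothMap.isSmooth_curry (Y := Y × Z) (Z := SmoothMap Z (SmoothMap Y A))
        (f := fun q => q.2 q.1.2 q.1.1)
        (SmoothMap.isSmooth_eval.comp ((isSmooth_fst.comp isSmooth_fst).prodMk
          (SmoothMap.isSmooth_eval.comp ((isSmooth_snd.comp isSmooth_fst).prodMk
            isSmooth_snd))))⟩ :
      SmoothMap (SmoothMap Z (SmoothMap Y A)) (SmoothMap (Y × Z) A))
  inv :=
    (⟨fun l => ⟨fun z => ⟨fun y => l (y, z), l.smooth.comp (isSmooth_id.prodMk (isSmooth_const z))⟩,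
        SmoothMap.isSmooth_curry l.smooth⟩,
      SmoothMap.isSmooth_curry (Y := Z) (Z := SmoothMap (Y × Z) A) (X := SmoothMap Y A)
        (SmoothMap.isSmooth_curry (Y := Y) (Z := Z × SmoothMap (Y × Z) A)
          (f := fun q => q.2.2 (q.1, q.2.1))
          (SmoothMap.isSmooth_eval.comp ((isSmooth_fst.prodMk
            (isSmooth_fst.comp isSmooth_snd)).prodMk (isSmooth_snd.comp isSmooth_snd))))⟩ :
      SmoothMap (SmoothMap (Y × Z) A) (SmoothMap Z (SmoothMap Y A)))
  hom_inv_id := rfl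
  inv_hom_id := rfl

/-- `(Z, W) ↦ (X ⊗ W)^Z`. -/
abbrev expWeil (X : FS.{u}) : FS.{u}ᵒᵖ × WeilAlg ⥤ FS.{u} :=
  (𝟭 FS.{u}ᵒᵖ).prod (weil.obj X) ⋙ Functor.uncurry.obj expFunctor

/-- `(X^Y ⊗ W)^Z ≅ (X ⊗ W)^(Y × Z)`, naturally in `Z` and `W`. -/
def expWeilExpIso {X Y : FS.{u}}
    (θ : weil.obj (exp Y X) ≅ weil.obj X ⋙ expFunctor.obj (Opposite.op Y)) :
    expWeil (exp Y X) ≅ (tensorLeft Y).op.prod (𝟭 WeilAlg) ⋙ expWeil X :=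
  NatIso.ofComponents
    (fun T => (expFunctor.obj T.1).mapIso (θ.app T.2) ≪≫
      expExpIso Y T.1.unop ((weil.obj X).obj T.2))
    fun {T T'} f => SmoothMap.ext <| funext fun k => SmoothMap.ext <| funext fun p =>
      congrArg (fun φ : SmoothMap (WeilProl (exp Y X) T.2.obj)
        (SmoothMap Y (WeilProl X T'.2.obj)) =>
          φ.toFun (SmoothMap.toFun k (f.1.unop p.2)) p.1) (θ.hom.naturality f.2)

/-- The chain is (X^Y ⊗ (W₁ ⊗ W₂))^Z ≅ (X ⊗ (W₁ ⊗ W₂))^(Y × Z) ≅ (X ⊗ W₁)^(Y × Z) ⊗ W₂ ≅ (X^Y ⊗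
W₁)^Z ⊗ W₂. The outer steps come from `κ`, and the middle one is the hypothesis on X at the exponent
Y × Z. -/
theorem WeilExponentiable.exp {X : FS.{u}} (hX : WeilExponentiable X) (Y : FS.{u}) :
    WeilExponentiable (exp Y X) := by
  obtain ⟨θ⟩ := hX.nonempty_weil_exp_iso Y
  obtain ⟨e⟩ := hX
  let κ := expWeilExpIso θ
  let T : FS.{u}ᵒᵖ × (WeilAlg × WeilAlg) ⥤ FS.{u}ᵒᵖ × (WeilAlg × WeilAlg) :=
    (tensorLeft Y).op.prod (𝟭 _)
  let i₁ : expOfWeil (FS.exp Y X) ≅ T ⋙ expOfWeil X :=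
    NatIso.ofComponents (fun S => κ.app (S.1, S.2.1 ⊗ S.2.2)) fun {S S'} f =>
      κ.hom.naturality ((f.1, f.2.1 ⊗ₘ f.2.2) : (S.1, S.2.1 ⊗ S.2.2) ⟶ (S'.1, S'.2.1 ⊗ S'.2.2))
  let i₂ : weilOfExp (FS.exp Y X) ≅ T ⋙ weilOfExp X :=
    NatIso.ofComponents (fun S => (weil.mapIso (κ.app (S.1, S.2.1))).app S.2.2) fun {S S'} f => by
      refine SmoothMap.ext <| funext <| ?_
      rintro ⟨⟨n, a, ha, k⟩⟩
      refine congrArg (WeilProl.mk (f.2.2.hom.hom ∘ a) fun i => (ha i).map _)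
        (SmoothMap.ext <| funext fun s => ?_)
      exact congrArg (fun φ : SmoothMap _ _ => φ (SmoothMap.toFun k s))
        (κ.hom.naturality ((f.1, f.2.1) : (S.1, S.2.1) ⟶ (S'.1, S'.2.1)))
  exact ⟨i₁ ≪≫ Functor.isoWhiskerLeft T e ≪≫ i₂.symm⟩

/-! ### The cartesian closed subcategory -/

theorem isMonoidal_isWEML : isWEML.{u}.IsMonoidal where
  prop_unit := ⟨weilExponentiable_unit, microlinear_unit⟩
  prop_tensor _ _ hX hY := ⟨hX.1.prod hY.1, hX.2.prod hY.2⟩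

/-- The cartesian monoidal structure on the full subcategory `FS_{WE,ML}`. -/
@[reducible]
def cartesianWEML : CartesianMonoidalCategory WEML.{u} where
  __ := have := isMonoidal_isWEML.{u}; ObjectProperty.fullMonoidalSubcategory isWEML.{u}
  isTerminalTensorUnit := .ofUniqueHom (fun X => ObjectProperty.homMk (toUnit X.1))
    fun _ _ => by ext1; apply toUnit_unique
  fst X Y := ObjectProperty.homMk (fst X.1 Y.1)
  snd X Y := ObjectProperty.homMk (snd X.1 Y.1)
  tensorProductIsBinaryProduct X Y :=
    BinaryFan.IsLimit.mk _ (fun f g => ObjectProperty.homMk (lift f.hom g.hom))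
      (by aesop_cat) (by aesop_cat) (by aesop_cat)
  fst_def X Y := by ext1; exact fst_def X.1 Y.1
  snd_def X Y := by ext1; exact snd_def X.1 Y.1

/-- The closed structure of `FS` given by the function spaces. -/
@[reducible]
def monoidalClosed : MonoidalClosed FS.{u} where
  closed Y := ⟨expFunctor.obj (Opposite.op Y), expAdjunction Y⟩

end FS

end

theorem theoremt3p5 :
    FS.isWEML.{u} (𝟙_ FS.{u}) ∧
    (∀ X Y : FS.{u}, FS.isWEML X → FS.isWEML Y → FS.isWEML (X ⊗ Y)) ∧
    (∀ X Y : FS.{u}, FS.isWEML X → FS.isWEML Y → FS.isWEML (FS.exp Y X)) ∧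
    (∀ Y : FS.{u}, ∃ adj : tensorLeft Y ⊣ FS.expFunctor.obj (Opposite.op Y),
      ∀ (X : FS.{u}) (y : Y) (f : SmoothMap Y X), adj.counit.app X (y, f) = f y) ∧
    ∃ (_ : CartesianMonoidalCategory FS.WEML.{u}) (_ : MonoidalClosed FS.WEML.{u})
      (_ : MonoidalClosed FS.{u}) (_ : PreservesFiniteProducts FS.isWEML.{u}.ι),
      MonoidalClosedFunctor FS.isWEML.{u}.ι := by
  refine ⟨⟨FS.weilExponentiable_unit, FS.microlinear_unit⟩,
    fun X Y hX hY => ⟨hX.1.prod hY.1, hX.2.prod hY.2⟩,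
    fun X Y hX _ => ⟨hX.1.exp Y, hX.2.exp hX.1 Y⟩,
    fun Y => ⟨FS.expAdjunction Y, FS.expAdjunction_counit_app Y⟩, ?_⟩
  have _ : FS.isWEML.{u}.IsMonoidal := FS.isMonoidal_isWEML
  let _ : MonoidalClosed FS.{u} := FS.monoidalClosed
  have _ : FS.isWEML.{u}.IsMonoidalClosed := ⟨fun Y X _ hX => ⟨hX.1.exp Y, hX.2.exp hX.1 Y⟩⟩
  let _ : CartesianMonoidalCategory FS.WEML.{u} := FS.cartesianWEML
  let _ : MonoidalClosed FS.WEML.{u} := ObjectProperty.fullMonoidalClosedSubcategory FS.isWEML.{u}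
  let _ : FS.isWEML.{u}.ι.Monoidal := ObjectProperty.monoidalι FS.isWEML.{u}
  have hp : PreservesFiniteProducts FS.isWEML.{u}.ι := inferInstance
  refine ⟨inferInstance, inferInstance, inferInstance, hp, ⟨fun A => ?_⟩⟩
  -- Products and function spaces of the subcategory are those of the ambient category. The product
  -- comparison is thus an identity, and the exponential comparison, its transpose followed by
  -- evaluation, is the curried evaluation, again an identity.
  have h : ∀ B, IsIso ((expComparison FS.isWEML.{u}.ι A).natTrans.app B) := by
    intro B
    have h1 : CartesianMonoidalCategory.prodComparison FS.isWEML.{u}.ι A ((ihom A).obj B) =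
        𝟙 _ := by
      apply CartesianMonoidalCategory.hom_ext
      · simp
        rfl
      · simp
        rfl
    have h2 := uncurry_expComparison FS.isWEML.{u}.ι A B
    rw [← MonoidalClosed.eq_curry_iff] at h2
    have h3 : (expComparison FS.isWEML.{u}.ι A).natTrans.app B = 𝟙 _ := by
      rw [h2]
      simp only [h1, IsIso.inv_id]
      exact (congrArg MonoidalClosed.curry ((Category.id_comp _).trans
        (MonoidalClosed.uncurry_id_eq_ev A.1 B.1).symm)).trans (MonoidalClosed.curry_uncurry _)
    rw [h3]
    exact IsIso.id _
  exact NatIso.isIso_of_isIso_app _
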